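/- Let $G$ be a compact Lie group acting continuously on a compact Hausdorff space $X$, and let $A$ be a Banach $\mathbb{R}$-algebra with unit. Let $\mathcal{A}$ be a locally trivial bundle on $X$ of Banach $\mathbb{R}$-algebras with fiber $A$ (near each point of $X$ there is a neighbourhood $U$ and a homeomorphism $\mathcal{A}|_U\cong U\times A$ over $U$ that is an isomorphism of unital $\mathbb{R}$-algebras on each fiber), with a continuous action of $G$ on its total space, covering the action on $X$, for which each $g\colon\mathcal{A}_x\to\mathcal{A}_{gx}$ is an algebra isomorphism. A $G$–$\mathcal{A}$ bundle on $X$ is a locally trivial bundle $E$ of left $\mathcal{A}$-modules on $X$ such that $\mathcal{A}\times_X E\to E$ is continuous and each fiber $E_x$ is a finitely generated projective $\mathcal{A}_x$-module, together with a continuous action of $G$ on its total space, covering the action on $X$ and additive on fibers, such that $g(a\cdot e)=g(a)\cdot g(e)$ for all $g\in G$, $x\in X$, $a\in\mathcal{A}_x$, $e\in E_x$. Here locally trivial means that each point of $X$ has a neighbourhood $U$ with a trivialization $\mathcal{A}|_U\cong U\times A$ as above and a homeomorphism $E|_U\cong U\times P$ over $U$, where $P$ is a Banach $A$-module (which may vary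 with the point), that is additive on fibers and carries the action of $\mathcal{A}_y$ on $E_y$ to the action of $A$ on $P$ for each $y\in U$. An isomorphism of $G$–$\mathcal{A}$ bundles is a $G$-equivariant homeomorphism of total spaces over $X$ that is $\mathcal{A}_x$-linear on each fiber. Then for every $G$–$\mathcal{A}$ bundle $E$ on $X$ there exist a $G$–$\mathcal{A}$ bundle $F$ on $X$ and a finite-dimensional real vector space $M$ with a continuous linear action of $G$ such that $E\oplus F$ is isomorphic, as a $G$–$\mathcal{A}$ bundle, to the "trivial" bundle $\mathcal{A}\otimes M$, whose fibers are $\mathcal{A}_x\otimes_{\mathbb{R}}M$ and on which $G$ acts diagonally. -/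

import Mathlib

open Bundle
open scoped Manifold ContDiff TensorProduct

universe u v w w'

/-- The total space of a family of fibers. It carries no topology by default. -/
abbrev Tot {X : Type*} (E : X → Type*) := Bundle.TotalSpace Unit E

/-- The topology on the total space of the fiber product of two families over `X`, as a subspace of
the product of their total spaces. -/
abbrev fiberProductTopology {X : Type*} (E : X → Type*) (F : X → Type*)
    [TopologicalSpace (Tot E)] [TopologicalSpace (Tot F)] :
    TopologicalSpace (Tot fun x => E x × F x) :=
  TopologicalSpace.induced
    (fun p => ((⟨p.proj, p.snd.1⟩, ⟨p.proj, p.snd.2⟩) : Tot E × Tot F)) inferInstance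

/-- A local trivialization that is an isomorphism of unital `ℝ`-algebras on each fiber. -/
def IsAlgebraTrivialization {X : Type*} [TopologicalSpace X] (Fiber : X → Type*)
    [∀ x, Ring (Fiber x)] [∀ x, Algebra ℝ (Fiber x)] [TopologicalSpace (Tot Fiber)]
    {A : Type*} [NormedRing A] [NormedAlgebra ℝ A]
    (e : Trivialization A (TotalSpace.proj : Tot Fiber → X)) : Prop :=
  ∀ y ∈ e.baseSet, ∃ f : Fiber y ≃ₐ[ℝ] A, ∀ a : Fiber y, (e ⟨y, a⟩).2 = f a

/-- A locally trivial bundle of Banach `ℝ`-algebras on `X` with fiber `A`: near each point there is a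
homeomorphism with `U × A` over `U` which is an isomorphism of unital `ℝ`-algebras on each fiber.
Transition functions need only be strongly continuous; they need not be isometric or norm-continuous. -/
structure BanachAlgebraBundle (X : Type*) [TopologicalSpace X]
    (A : Type*) [NormedRing A] [NormedAlgebra ℝ A] where
  Fiber : X → Type v
  [ring : ∀ x, Ring (Fiber x)]
  [algebra : ∀ x, Algebra ℝ (Fiber x)]
  [top : TopologicalSpace (Tot Fiber)]
  locally_trivial : ∀ x : X, ∃ e : Trivialization A (TotalSpace.proj : Tot Fiber → X),
    x ∈ e.baseSet ∧ IsAlgebraTrivialization Fiber e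

attribute [instance] BanachAlgebraBundle.ring BanachAlgebraBundle.algebra BanachAlgebraBundle.top

/-- A bundle of Banach algebras on the `G`-space `X` with a continuous action of `G` on its total
space, covering the action on `X` and given by algebra isomorphisms `𝒜 x → 𝒜 (g • x)`. -/
structure GAlgebraBundle (G : Type*) [Group G] [TopologicalSpace G]
    (X : Type*) [TopologicalSpace X] [MulAction G X]
    (A : Type*) [NormedRing A] [NormedAlgebra ℝ A] extends BanachAlgebraBundle.{v} X A where
  act : ∀ (g : G) (x : X), Fiber x ≃ₐ[ℝ] Fiber (g • x)
  act_one : ∀ (x : X) (a : Fiber x), (⟨(1 : G) • x, act 1 x a⟩ : Tot Fiber) = ⟨x, a⟩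
  act_mul : ∀ (g h : G) (x : X) (a : Fiber x),
    (⟨(g * h) • x, act (g * h) x a⟩ : Tot Fiber) = ⟨g • h • x, act g (h • x) (act h x a)⟩
  continuous_act : Continuous fun p : G × Tot Fiber =>
    (⟨p.1 • p.2.1, act p.1 p.2.1 p.2.2⟩ : Tot Fiber)

section

variable {G : Type*} [Group G] [TopologicalSpace G]
  {X : Type*} [TopologicalSpace X] [MulAction G X]
  {A : Type*} [NormedRing A] [NormedAlgebra ℝ A]

/-- The data underlying a `G`-`𝒜` bundle: left `𝒜 x`-modules `E x`, a topology on their total space,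
and additive maps `E x → E (g • x)`. The axioms are those of `IsGBundle` below. -/
structure GModuleFamily (𝒜 : GAlgebraBundle.{v} G X A) where
  Fiber : X → Type w
  [addCommGroup : ∀ x, AddCommGroup (Fiber x)]
  [module : ∀ x, Module (𝒜.Fiber x) (Fiber x)]
  [top : TopologicalSpace (Tot Fiber)]
  act : ∀ (g : G) (x : X), Fiber x →+ Fiber (g • x)

attribute [instance] GModuleFamily.addCommGroup GModuleFamily.module GModuleFamily.top

namespace GModuleFamily

variable {𝒜 : GAlgebraBundle.{v} G X A}

/-- `E` is locally trivial as a bundle of `𝒜`-modules: near each point there are a trivialization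
of `𝒜` with fiber the algebra `A` and a trivialization of `E` with fiber a Banach `A`-module `P`,
which carry the action of `𝒜 y` on `E y` to the action of `A` on `P`. The module `P` may vary
with the point. -/
def IsLocallyTrivial (E : GModuleFamily.{v, w} 𝒜) : Prop :=
  ∀ x : X, ∃ (P : Type w) (_ : NormedAddCommGroup P) (_ : NormedSpace ℝ P) (_ : CompleteSpace P)
    (_ : Module A P) (_ : IsScalarTower ℝ A P) (_ : ContinuousSMul A P)
    (e : Trivialization A (TotalSpace.proj : Tot 𝒜.Fiber → X))
    (ε : Trivialization P (TotalSpace.proj : Tot E.Fiber → X)),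
    x ∈ e.baseSet ∧ x ∈ ε.baseSet ∧ IsAlgebraTrivialization 𝒜.Fiber e ∧
    ∀ y ∈ e.baseSet ∩ ε.baseSet,
      (∀ s t : E.Fiber y, (ε ⟨y, s + t⟩).2 = (ε ⟨y, s⟩).2 + (ε ⟨y, t⟩).2) ∧
      (∀ (a : 𝒜.Fiber y) (s : E.Fiber y), (ε ⟨y, a • s⟩).2 = (e ⟨y, a⟩).2 • (ε ⟨y, s⟩).2)

/-- `E` is a `G`-`𝒜` bundle. -/
structure IsGBundle (E : GModuleFamily.{v, w} 𝒜) : Prop where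
  locally_trivial : E.IsLocallyTrivial
  /-- The multiplication `𝒜 ×_X E → E` is continuous. -/
  continuous_smul : @Continuous (Tot fun x => 𝒜.Fiber x × E.Fiber x) (Tot E.Fiber)
    (fiberProductTopology 𝒜.Fiber E.Fiber) E.top (fun p => ⟨p.proj, p.snd.1 • p.snd.2⟩)
  finite : ∀ x, Module.Finite (𝒜.Fiber x) (E.Fiber x)
  projective : ∀ x, Module.Projective (𝒜.Fiber x) (E.Fiber x)
  act_one : ∀ (x : X) (s : E.Fiber x), (⟨(1 : G) • x, E.act 1 x s⟩ : Tot E.Fiber) = ⟨x, s⟩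
  act_mul : ∀ (g h : G) (x : X) (s : E.Fiber x),
    (⟨(g * h) • x, E.act (g * h) x s⟩ : Tot E.Fiber) = ⟨g • h • x, E.act g (h • x) (E.act h x s)⟩
  continuous_act : Continuous fun p : G × Tot E.Fiber =>
    (⟨p.1 • p.2.1, E.act p.1 p.2.1 p.2.2⟩ : Tot E.Fiber)
  act_smul : ∀ (g : G) (x : X) (a : 𝒜.Fiber x) (s : E.Fiber x),
    E.act g x (a • s) = 𝒜.act g x a • E.act g x s

/-- The Whitney sum, with total space topologized as the fiber product of the total spaces. -/
def sum (E : GModuleFamily.{v, w} 𝒜) (F : GModuleFamily.{v, w'} 𝒜) :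
    GModuleFamily.{v, max w w'} 𝒜 where
  Fiber x := E.Fiber x × F.Fiber x
  top := fiberProductTopology E.Fiber F.Fiber
  act g x := (E.act g x).prodMap (F.act g x)

/-- The bundle `𝒜 ⊗ M` for a real representation `M` of `G`, with fibers `𝒜 x ⊗[ℝ] M` and diagonal
action. The topology is the coarsest one for which the contractions `𝒜 ⊗ M → 𝒜` against linear
functionals on `M` are continuous; for a basis of `M` with `n` elements it is the topology of the
`n`-fold fiber product of `𝒜` over `X`. -/
noncomputable def tensor (𝒜 : GAlgebraBundle.{v} G X A) {M : Type u} [AddCommGroup M] [Module ℝ M]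
    (ρ : Representation ℝ G M) : GModuleFamily.{v, max v u} 𝒜 where
  Fiber x := 𝒜.Fiber x ⊗[ℝ] M
  top := TopologicalSpace.induced TotalSpace.proj inferInstance ⊓
    ⨅ f : Module.Dual ℝ M, TopologicalSpace.induced
      (fun p => (⟨p.proj, TensorProduct.rid ℝ (𝒜.Fiber p.proj)
        (f.lTensor (𝒜.Fiber p.proj) p.snd)⟩ : Tot 𝒜.Fiber)) inferInstance
  act g x := (TensorProduct.map (𝒜.act g x).toLinearMap (ρ g)).toAddMonoidHom

/-- Isomorphism of `G`-`𝒜` bundles: a `G`-equivariant homeomorphism of total spaces over `X` which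
is `𝒜 x`-linear on each fiber. -/
def Isomorphic (E : GModuleFamily.{v, w} 𝒜) (F : GModuleFamily.{v, w'} 𝒜) : Prop :=
  ∃ φ : ∀ x, E.Fiber x ≃ₗ[𝒜.Fiber x] F.Fiber x,
    Continuous (fun p => ⟨p.proj, φ p.proj p.snd⟩ : Tot E.Fiber → Tot F.Fiber) ∧
    Continuous (fun p => ⟨p.proj, (φ p.proj).symm p.snd⟩ : Tot F.Fiber → Tot E.Fiber) ∧
    ∀ (g : G) (x : X) (s : E.Fiber x), φ (g • x) (E.act g x s) = F.act g x (φ x s)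

end GModuleFamily

end

/-! It suffices to find a continuous equivariant surjection `pr` from some `T = 𝒜 ⊗ M` onto `E` with
a continuous equivariant right inverse `σ`: then `F = ker pr`, and `(e, k) ↦ σ e + k` is the
isomorphism.

To give an equivariant map `𝒜 ⊗ M → E` is to give an equivariant linear map from `M` to sections of
`E`; it is surjective when the image of `M` generates every fiber. Compactness of `X` provides
finitely many continuous generating sections `s i`, which in general span no invariant
finite-dimensional space. For a weight `w ∈ L²(G)`, put `smear w s = ∫ w(g) (g · s) dg`. This is
linear in `w` and intertwines left translation on `L²(G)` with the action on sections (`act_smear`).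
If `w` is a probability density concentrated near `1`, the smeared sections are uniformly close to
the `s i` in local charts, hence still generate, and generation persists for weights near `w` in
`L²`. Vectors lying in finite-dimensional invariant subspaces are dense in `L²(G)`
(`exists_finiteDimensional_invariant`, the Peter-Weyl argument), so some such vector `w₁ ∈ W` gives
generating sections; `M` is the sum of copies of `W`, one for each `s i`.

Both the stability of generation and the splitting rest on `exists_splitting`. A surjection `A^d →
P` onto a projective Banach module, paired with a projection `κ` to its kernel `K`, is an
isomorphism `A^d ≅ P × K`, and with the same `κ` it stays one under small changes of the surjection,
because invertible operators form an open set. Hence `pr` is locally the projection `P × K → P`.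
Local right inverses are glued with bump functions, and the result is averaged over `G` by Haar
measure. The same charts make the kernel locally trivial.

Transition functions are only strongly continuous, so families of linear maps are not treated as
sections of a Hom bundle: continuity always means joint continuity in base point and vector, and
integrals are taken fiber by fiber. -/

section GBundleEmbedding

open Bundle Set Filter MeasureTheory
open scoped Manifold ContDiff TensorProduct Topology
set_option linter.unusedSectionVars false
set_option linter.style.haveILetI false

universe p p' uA

/-! ### Fiberwise linear charts and continuity of fiberwise operations -/

/-- A local chart of a family of real vector spaces with model the normed space `P`, linear on each
fiber. -/
structure LinearChart {X : Type*} [TopologicalSpace X] (B : X → Type*)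
    [∀ x, AddCommGroup (B x)] [∀ x, Module ℝ (B x)] [TopologicalSpace (Tot B)]
    (P : Type*) [NormedAddCommGroup P] [NormedSpace ℝ P] where
  domain : Set X
  isOpen_domain : IsOpen domain
  coord : ∀ y, B y →ₗ[ℝ] P
  symm : ∀ y, P →ₗ[ℝ] B y
  symm_coord : ∀ y ∈ domain, ∀ b, symm y (coord y b) = b
  coord_symm : ∀ y ∈ domain, ∀ p, coord y (symm y p) = p
  continuousOn_coord : ContinuousOn (fun p : Tot B => coord p.proj p.snd)
    (TotalSpace.proj ⁻¹' domain)
  continuousOn_symm : ContinuousOn (fun z : X × P => (⟨z.1, symm z.1 z.2⟩ : Tot B))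
    (domain ×ˢ univ)

namespace LinearChart

variable {X : Type*} [TopologicalSpace X] {B : X → Type*}
    [∀ x, AddCommGroup (B x)] [∀ x, Module ℝ (B x)] [TopologicalSpace (Tot B)]
    {P : Type*} [NormedAddCommGroup P] [NormedSpace ℝ P]
    {Z : Type*} [TopologicalSpace Z]

theorem injective_coord (c : LinearChart B P) {y : X} (hy : y ∈ c.domain) :
    Function.Injective (c.coord y) :=
  Function.LeftInverse.injective (c.symm_coord y hy)

/-- The basic tool for continuity into a total space: once the base point is known to move
continuously, only the coordinate in a fixed normed space has to be examined. -/
theorem continuousAt_iff (c : LinearChart B P) {q : Z → X} {h : ∀ z, B (q z)} {z₀ : Z}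
    (hq : ContinuousAt q z₀) (hz : q z₀ ∈ c.domain) :
    ContinuousAt (fun z => (⟨q z, h z⟩ : Tot B)) z₀ ↔
      ContinuousAt (fun z => c.coord (q z) (h z)) z₀ := by
  have hU : ∀ᶠ z in 𝓝 z₀, q z ∈ c.domain := hq (c.isOpen_domain.mem_nhds hz)
  constructor
  · intro hc
    exact Tendsto.comp (c.continuousOn_coord ⟨q z₀, h z₀⟩ hz)
      (tendsto_nhdsWithin_iff.2 ⟨hc, hU⟩)
  · intro hc
    have h1 : Tendsto (fun z => (q z, c.coord (q z) (h z))) (𝓝 z₀)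
        (𝓝[c.domain ×ˢ univ] (q z₀, c.coord (q z₀) (h z₀))) :=
      tendsto_nhdsWithin_iff.2 ⟨hq.prodMk hc, by filter_upwards [hU] with z hz using ⟨hz, trivial⟩⟩
    have h2 := (c.continuousOn_symm (q z₀, c.coord (q z₀) (h z₀)) ⟨hz, trivial⟩).tendsto.comp h1
    simp only [c.symm_coord _ hz] at h2
    refine Tendsto.congr' ?_ h2
    filter_upwards [hU] with z hz
    simp [c.symm_coord _ hz]

theorem continuousAt_symm (c : LinearChart B P) {q : Z → X} {p : Z → P} {z₀ : Z}
    (hq : ContinuousAt q z₀) (hz : q z₀ ∈ c.domain) (hp : ContinuousAt p z₀) :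
    ContinuousAt (fun z => (⟨q z, c.symm (q z) (p z)⟩ : Tot B)) z₀ := by
  rw [c.continuousAt_iff hq hz]
  refine hp.congr ?_
  filter_upwards [hq (c.isOpen_domain.mem_nhds hz)] with z hz
  simp [c.coord_symm _ hz]

open Classical in
/-- A chart from a trivialization which is linear on each fiber over the open set `U`. -/
noncomputable def ofTrivialization (ε : Trivialization P (TotalSpace.proj : Tot B → X)) {U : Set X}
    (hU : IsOpen U) (hUε : U ⊆ ε.baseSet)
    (hf : ∀ y ∈ U, ∃ f : B y ≃ₗ[ℝ] P, ∀ s, (ε ⟨y, s⟩).2 = f s) : LinearChart B P where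
  domain := U
  isOpen_domain := hU
  coord y := if h : y ∈ U then (hf y h).choose else 0
  symm y := if h : y ∈ U then (hf y h).choose.symm else 0
  symm_coord y hy b := by simp [hy]
  coord_symm y hy b := by simp [hy]
  continuousOn_coord := by
    have : ContinuousOn (fun p : Tot B => (ε p).2) (TotalSpace.proj ⁻¹' U) :=
      continuous_snd.comp_continuousOn
        (ε.toOpenPartialHomeomorph.continuousOn.mono (ε.preimage_subset_source hUε))
    refine this.congr ?_
    rintro ⟨y, b⟩ hy
    have hy : y ∈ U := hy
    simp [hy, (hf y hy).choose_spec b]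
  continuousOn_symm := by
    have : ContinuousOn (fun z : X × P => ε.toOpenPartialHomeomorph.symm z) (U ×ˢ univ) :=
      ε.toOpenPartialHomeomorph.continuousOn_symm.mono
        (by rw [ε.target_eq]; exact prod_mono_left hUε)
    refine this.congr ?_
    rintro ⟨y, p⟩ ⟨hy, -⟩
    have hy : y ∈ U := hy
    have hs : (⟨y, (hf y hy).choose.symm p⟩ : Tot B) ∈ ε.source := ε.mem_source.2 (hUε hy)
    have h1 : ε ⟨y, (hf y hy).choose.symm p⟩ = (y, p) := by
      refine Prod.ext (ε.coe_fst hs) ?_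
      rw [(hf y hy).choose_spec]; simp
    simp only [hy, dif_pos]
    have h2 := ε.left_inv hs
    exact (h2.symm.trans (congrArg ε.toOpenPartialHomeomorph.symm h1))

theorem coord_ofTrivialization (ε : Trivialization P (TotalSpace.proj : Tot B → X)) {U : Set X}
    (hU : IsOpen U) (hUε : U ⊆ ε.baseSet)
    (hf : ∀ y ∈ U, ∃ f : B y ≃ₗ[ℝ] P, ∀ s, (ε ⟨y, s⟩).2 = f s) {y : X} (hy : y ∈ U) (b : B y) :
    (ofTrivialization ε hU hUε hf).coord y b = (ε ⟨y, b⟩).2 := by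
  simp [ofTrivialization, hy, (hf y hy).choose_spec b]

/-- The trivialization given by a chart. -/
def toTrivialization (c : LinearChart B P)
    (hproj : Continuous (TotalSpace.proj : Tot B → X)) :
    Trivialization P (TotalSpace.proj : Tot B → X) where
  toFun p := (p.proj, c.coord p.proj p.snd)
  invFun z := ⟨z.1, c.symm z.1 z.2⟩
  source := TotalSpace.proj ⁻¹' c.domain
  target := c.domain ×ˢ univ
  map_source' p hp := ⟨hp, trivial⟩
  map_target' z hz := hz.1
  left_inv' p hp := by rw [c.symm_coord _ hp]
  right_inv' z hz := by rw [c.coord_symm _ hz.1]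
  open_source := c.isOpen_domain.preimage hproj
  open_target := c.isOpen_domain.prod isOpen_univ
  continuousOn_toFun := hproj.continuousOn.prodMk c.continuousOn_coord
  continuousOn_invFun := c.continuousOn_symm
  baseSet := c.domain
  open_baseSet := c.isOpen_domain
  source_eq := rfl
  target_eq := rfl
  proj_toFun _ _ := rfl

/-- Composition of a chart with a continuous family of linear isomorphisms of the model. -/
noncomputable def trans (c : LinearChart B P) {Q : Type*} [NormedAddCommGroup Q] [NormedSpace ℝ Q]
    {V : Set X} (hV : IsOpen V) (hVc : V ⊆ c.domain) (l : X → P →L[ℝ] Q) (r : X → Q →L[ℝ] P)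
    (hl : ContinuousOn l V) (hr : ContinuousOn r V) (hlr : ∀ y ∈ V, ∀ q, l y (r y q) = q)
    (hrl : ∀ y ∈ V, ∀ p, r y (l y p) = p) (hproj : Continuous (TotalSpace.proj : Tot B → X)) :
    LinearChart B Q where
  domain := V
  isOpen_domain := hV
  coord y := (l y).toLinearMap ∘ₗ c.coord y
  symm y := c.symm y ∘ₗ (r y).toLinearMap
  symm_coord y hy b := by simp [hrl y hy, c.symm_coord y (hVc hy)]
  coord_symm y hy b := by simp [hlr y hy, c.coord_symm y (hVc hy)]
  continuousOn_coord := by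
    have h1 : ContinuousOn (fun p : Tot B => l p.proj) (TotalSpace.proj ⁻¹' V) :=
      hl.comp hproj.continuousOn fun _ h => h
    exact h1.clm_apply (c.continuousOn_coord.mono (preimage_mono hVc))
  continuousOn_symm := by
    have h1 : ContinuousOn (fun z : X × Q => r z.1 z.2) (V ×ˢ univ) :=
      (hr.comp continuousOn_fst fun _ h => h.1).clm_apply continuousOn_snd
    exact c.continuousOn_symm.comp (continuousOn_fst.prodMk h1) fun z hz => ⟨hVc hz.1, trivial⟩

end LinearChart

/-- A family of real vector spaces which is near each point of the base isomorphic to a product with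
a Banach space. -/
def IsBanachBundle {X : Type*} [TopologicalSpace X] (B : X → Type*)
    [∀ x, AddCommGroup (B x)] [∀ x, Module ℝ (B x)] [TopologicalSpace (Tot B)] : Prop :=
  Continuous (TotalSpace.proj : Tot B → X) ∧
  ∀ x : X, ∃ (P : Type p) (_ : NormedAddCommGroup P) (_ : NormedSpace ℝ P) (_ : CompleteSpace P)
    (c : LinearChart B P), x ∈ c.domain

namespace IsBanachBundle

variable {X : Type*} [TopologicalSpace X] {B : X → Type*}
    [∀ x, AddCommGroup (B x)] [∀ x, Module ℝ (B x)] [TopologicalSpace (Tot B)]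
    {Z : Type*} [TopologicalSpace Z] {q : Z → X}

theorem continuousAt_add (hB : IsBanachBundle.{p} B) {h k : ∀ z, B (q z)} {z₀ : Z}
    (hq : ContinuousAt q z₀) (hh : ContinuousAt (fun z => (⟨q z, h z⟩ : Tot B)) z₀)
    (hk : ContinuousAt (fun z => (⟨q z, k z⟩ : Tot B)) z₀) :
    ContinuousAt (fun z => (⟨q z, h z + k z⟩ : Tot B)) z₀ := by
  obtain ⟨P, _, _, _, c, hc⟩ := hB.2 (q z₀)
  rw [c.continuousAt_iff hq hc] at *
  simp only [map_add]
  exact hh.add hk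

theorem continuousAt_smul (hB : IsBanachBundle.{p} B) {r : Z → ℝ} {h : ∀ z, B (q z)} {z₀ : Z}
    (hq : ContinuousAt q z₀) (hr : ContinuousAt r z₀)
    (hh : ContinuousAt (fun z => (⟨q z, h z⟩ : Tot B)) z₀) :
    ContinuousAt (fun z => (⟨q z, r z • h z⟩ : Tot B)) z₀ := by
  obtain ⟨P, _, _, _, c, hc⟩ := hB.2 (q z₀)
  rw [c.continuousAt_iff hq hc] at *
  simp only [map_smul]
  exact hr.smul hh

theorem continuousAt_zero (hB : IsBanachBundle.{p} B) {z₀ : Z} (hq : ContinuousAt q z₀) :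
    ContinuousAt (fun z => (⟨q z, 0⟩ : Tot B)) z₀ := by
  obtain ⟨P, _, _, _, c, hc⟩ := hB.2 (q z₀)
  rw [c.continuousAt_iff hq hc]
  simpa using continuousAt_const

theorem continuous_add (hB : IsBanachBundle.{p} B) {h k : ∀ z, B (q z)} (hq : Continuous q)
    (hh : Continuous (fun z => (⟨q z, h z⟩ : Tot B)))
    (hk : Continuous (fun z => (⟨q z, k z⟩ : Tot B))) :
    Continuous (fun z => (⟨q z, h z + k z⟩ : Tot B)) :=
  continuous_iff_continuousAt.2 fun _ =>
    hB.continuousAt_add hq.continuousAt hh.continuousAt hk.continuousAt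

theorem continuous_smul (hB : IsBanachBundle.{p} B) {r : Z → ℝ} {h : ∀ z, B (q z)}
    (hq : Continuous q) (hr : Continuous r) (hh : Continuous (fun z => (⟨q z, h z⟩ : Tot B))) :
    Continuous (fun z => (⟨q z, r z • h z⟩ : Tot B)) :=
  continuous_iff_continuousAt.2 fun _ =>
    hB.continuousAt_smul hq.continuousAt hr.continuousAt hh.continuousAt

theorem continuous_sub (hB : IsBanachBundle.{p} B) {h k : ∀ z, B (q z)} (hq : Continuous q)
    (hh : Continuous (fun z => (⟨q z, h z⟩ : Tot B)))
    (hk : Continuous (fun z => (⟨q z, k z⟩ : Tot B))) :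
    Continuous (fun z => (⟨q z, h z - k z⟩ : Tot B)) := by
  have := hB.continuous_add hq hh (hB.continuous_smul (r := fun _ => -1) hq continuous_const hk)
  simpa [sub_eq_add_neg] using this

theorem continuous_sum (hB : IsBanachBundle.{p} B) {ι : Type*} (s : Finset ι)
    {h : ι → ∀ z, B (q z)} (hq : Continuous q)
    (hh : ∀ i ∈ s, Continuous (fun z => (⟨q z, h i z⟩ : Tot B))) :
    Continuous (fun z => (⟨q z, ∑ i ∈ s, h i z⟩ : Tot B)) := by
  classical
  induction s using Finset.induction_on with
  | empty =>
    simpa using continuous_iff_continuousAt.2 fun z => hB.continuousAt_zero hq.continuousAt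
  | insert i s hi ih =>
    simp only [Finset.sum_insert hi]
    exact hB.continuous_add hq (hh i (Finset.mem_insert_self _ _))
      (ih fun j hj => hh j (Finset.mem_insert_of_mem hj))

/-- Extension by zero of a lift defined over an open set, after multiplication by a cutoff. -/
theorem continuous_smul_of_tsupport (hB : IsBanachBundle.{p} B) {χ : X → ℝ} (hχ : Continuous χ)
    {U : Set X} (hχU : tsupport χ ⊆ U) {h : ∀ z, B (q z)} (hq : Continuous q)
    (hh : ∀ z, q z ∈ U → ContinuousAt (fun z => (⟨q z, h z⟩ : Tot B)) z) :
    Continuous (fun z => (⟨q z, χ (q z) • h z⟩ : Tot B)) := by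
  refine continuous_iff_continuousAt.2 fun z => ?_
  by_cases hz : q z ∈ tsupport χ
  · exact hB.continuousAt_smul hq.continuousAt (hχ.comp hq).continuousAt (hh z (hχU hz))
  · refine (hB.continuousAt_zero hq.continuousAt).congr ?_
    have : ∀ᶠ z' in 𝓝 z, q z' ∈ (tsupport χ)ᶜ :=
      hq.continuousAt ((isClosed_tsupport χ).isOpen_compl.mem_nhds hz)
    filter_upwards [this] with z' hz'
    rw [image_eq_zero_of_notMem_tsupport hz', zero_smul]

end IsBanachBundle

/-! ### Finite-dimensional invariant subspaces of orthogonal representations -/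

section PeterWeyl

open scoped InnerProductSpace

variable {G : Type*} [Group G] [TopologicalSpace G] [IsTopologicalGroup G] [CompactSpace G]
  [SecondCountableTopology G] [MeasurableSpace G] [BorelSpace G]
  (μ : Measure G) [IsProbabilityMeasure μ]
  {H : Type*} [NormedAddCommGroup H] [InnerProductSpace ℝ H]

/-- The integral of the rank one operators of a family of vectors. -/
noncomputable def gramOperator (K : G → H) : H →L[ℝ] H :=
  ∫ y, InnerProductSpace.rankOne ℝ (K y) (K y) ∂μ

variable {K : G → H}

theorem integrable_rankOne (hK : Continuous K) :
    Integrable (fun y => InnerProductSpace.rankOne ℝ (K y) (K y)) μ := by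
  have : Continuous fun y => InnerProductSpace.rankOne ℝ (K y) (K y) :=
    ((InnerProductSpace.rankOne ℝ).continuous.comp hK).clm_apply hK
  exact this.integrable_of_hasCompactSupport (HasCompactSupport.of_compactSpace _)

theorem gramOperator_apply (hK : Continuous K) (v : H) :
    gramOperator μ K v = ∫ y, ⟪K y, v⟫_ℝ • K y ∂μ := by
  rw [gramOperator, ContinuousLinearMap.integral_apply (integrable_rankOne μ hK)]
  simp

variable [CompleteSpace H]

theorem inner_gramOperator (hK : Continuous K) (v w : H) :
    ⟪w, gramOperator μ K v⟫_ℝ = ∫ y, ⟪K y, v⟫_ℝ * ⟪K y, w⟫_ℝ ∂μ := by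
  have hi : Integrable (fun y => ⟪K y, v⟫_ℝ • K y) μ := by
    have : Continuous fun y => ⟪K y, v⟫_ℝ • K y := by fun_prop
    exact this.integrable_of_hasCompactSupport (HasCompactSupport.of_compactSpace _)
  rw [gramOperator_apply μ hK, ← integral_inner hi]
  simp [inner_smul_right, real_inner_comm]

theorem isSymmetric_gramOperator (hK : Continuous K) :
    (gramOperator μ K).IsSymmetric := by
  intro v w
  simp only [ContinuousLinearMap.coe_coe]
  rw [real_inner_comm, inner_gramOperator μ hK, inner_gramOperator μ hK]
  simp [mul_comm]

/-- The compact operators form a closed convex set containing each rank one integrand, and the mean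
over a probability measure stays in such a set. -/
theorem isCompactOperator_gramOperator (hK : Continuous K) :
    IsCompactOperator (gramOperator μ K) := by
  refine Convex.integral_mem (s := (compactOperator (RingHom.id ℝ) H H : Set (H →L[ℝ] H)))
    (compactOperator (RingHom.id ℝ) H H).convex isClosed_setOfPred_isCompactOperator
    (Eventually.of_forall fun y => ?_) (integrable_rankOne μ hK)
  have h1 : IsCompactOperator (ContinuousLinearMap.toSpanSingleton ℝ (K y)) :=
    isCompactOperator_of_locallyCompactSpace_rng _
  exact h1.comp_clm (innerSL ℝ (K y))

/-- Pairing with `v` gives `∫ ⟪K y, v⟫² = 0`. The integrand is continuous and nonnegative, and open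
sets have positive measure, so it vanishes everywhere and not just almost everywhere. -/
theorem inner_eq_zero_of_gramOperator_eq_zero [μ.IsOpenPosMeasure] (hK : Continuous K)
    {v : H} (hv : gramOperator μ K v = 0) (y : G) : ⟪K y, v⟫_ℝ = 0 := by
  have h := inner_gramOperator μ hK v v
  rw [hv, inner_zero_right] at h
  have hc : Continuous fun y => ⟪K y, v⟫_ℝ * ⟪K y, v⟫_ℝ := by fun_prop
  have h0 : (fun y => ⟪K y, v⟫_ℝ * ⟪K y, v⟫_ℝ) =ᵐ[μ] 0 :=
    (integral_eq_zero_iff_of_nonneg (fun y => mul_self_nonneg _)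
      (hc.integrable_of_hasCompactSupport (HasCompactSupport.of_compactSpace _))).1 h.symm
  have := congrFun (Continuous.ae_eq_iff_eq μ hc continuous_const |>.1 h0) y
  exact mul_self_eq_zero.1 this

/-- Substitute `y ↦ g * y` in the integral; orthogonality removes `U g` from the inner product.
Consequently the eigenspaces are invariant. -/
theorem gramOperator_comm [μ.IsMulLeftInvariant] (U : G →* (H →L[ℝ] H)) (hU : ∀ g v, ‖U g v‖ = ‖v‖)
    (hc : ∀ v, Continuous fun g => U g v) (φ : H) (g : G) (v : H) :
    gramOperator μ (fun y => U y φ) (U g v) = U g (gramOperator μ (fun y => U y φ) v) := by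
  have hi : Integrable (fun y => ⟪U y φ, v⟫_ℝ • U y φ) μ := by
    have := hc φ
    have : Continuous fun y => ⟪U y φ, v⟫_ℝ • U y φ := by fun_prop
    exact this.integrable_of_hasCompactSupport (HasCompactSupport.of_compactSpace _)
  rw [gramOperator_apply μ (hc φ), gramOperator_apply μ (hc φ),
    ← ContinuousLinearMap.integral_comp_comm _ hi,
    ← integral_mul_left_eq_self _ g]
  refine integral_congr_ae (Eventually.of_forall fun y => ?_)
  have hinner : ⟪U g (U y φ), U g v⟫_ℝ = ⟪U y φ, v⟫_ℝ :=
    LinearIsometry.inner_map_map ⟨(U g).toLinearMap, hU g⟩ _ _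
  simp [map_mul, hinner]

/-- Vectors with finite-dimensional orbit span are dense in an orthogonal representation of a compact
group. -/
theorem exists_finiteDimensional_invariant {G : Type*} [Group G] [TopologicalSpace G]
    [IsTopologicalGroup G] [CompactSpace G] [SecondCountableTopology G] [T2Space G]
    {H : Type*} [NormedAddCommGroup H] [InnerProductSpace ℝ H] [CompleteSpace H]
    (U : G →* (H →L[ℝ] H)) (hU : ∀ g v, ‖U g v‖ = ‖v‖)
    (hc : ∀ v, Continuous fun g => U g v) (φ : H) {s : Set H} (hs : s ∈ 𝓝 φ) :
    ∃ W : Submodule ℝ H, FiniteDimensional ℝ W ∧ (∀ g, ∀ w ∈ W, U g w ∈ W) ∧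
      ∃ w ∈ W, w ∈ s := by
  classical
  borelize G
  let μ : Measure G := Measure.haarMeasure ⊤
  have : IsProbabilityMeasure μ := ⟨Measure.haarMeasure_self (K₀ := ⊤)⟩
  set T := gramOperator μ fun y => U y φ with hT
  have hcomp : IsCompactOperator T := isCompactOperator_gramOperator μ (hc φ)
  have hsymm : T.IsSymmetric := isSymmetric_gramOperator μ (hc φ)
  let S : Submodule ℝ H := ⨆ a : {a : ℝ // a ≠ 0}, Module.End.eigenspace T.toLinearMap a
  -- By double orthogonality it is enough that every `f ⟂ S` is orthogonal to `φ`. Split `f = f0 +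
  -- f1` along `ker T`. Then `f1` is orthogonal to all eigenspaces, that of `0` included, so it
  -- vanishes by the spectral theorem. Thus `f ∈ ker T`, and the kernel is orthogonal to `U 1 φ =
  -- φ`.
  have hφ : φ ∈ S.topologicalClosure := by
    rw [← Submodule.orthogonal_orthogonal_eq_closure]
    intro f hf
    have hker : IsClosed (LinearMap.ker T.toLinearMap : Set H) := T.isClosed_ker
    have : CompleteSpace (LinearMap.ker T.toLinearMap) := hker.completeSpace_coe
    obtain ⟨f0, hf0, f1, hf1, rfl⟩ :=
      (LinearMap.ker T.toLinearMap).exists_add_mem_mem_orthogonal f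
    have h1 : f1 ∈ (⨆ a, Module.End.eigenspace T.toLinearMap a)ᗮ := by
      rw [Submodule.mem_orthogonal]
      intro u hu
      induction hu using Submodule.iSup_induction' with
      | mem a u hu =>
        by_cases ha : a = 0
        · refine (Submodule.mem_orthogonal _ _).1 hf1 u ?_
          subst ha
          rwa [Module.End.eigenspace_zero] at hu
        · have h2 := (Submodule.mem_orthogonal _ _).1 hf u
            (Submodule.mem_iSup_of_mem (⟨a, ha⟩ : {a : ℝ // a ≠ 0}) hu)
          rw [inner_add_right] at h2
          have h3 : ⟪u, f0⟫_ℝ = 0 := by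
            have e1 : T u = a • u := Module.End.mem_eigenspace_iff.1 hu
            have e2 : T f0 = 0 := hf0
            have e3 : ⟪T u, f0⟫_ℝ = ⟪u, T f0⟫_ℝ := hsymm u f0
            rw [e1, e2, inner_zero_right, inner_smul_left] at e3
            simpa [ha] using e3
          rwa [h3, zero_add] at h2
      | zero => simp
      | add u v _ _ hu hv => rw [inner_add_left, hu, hv, add_zero]
    rw [ContinuousLinearMap.orthogonalComplement_iSup_eigenspaces_eq_bot hcomp hsymm,
      Submodule.mem_bot] at h1
    have h4 := inner_eq_zero_of_gramOperator_eq_zero μ (hc φ) (v := f0) hf0 1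
    rw [h1, add_zero, real_inner_comm]
    simpa using h4
  obtain ⟨w, hws, hwS⟩ := mem_closure_iff_nhds.1 hφ s hs
  obtain ⟨t, ht⟩ := Submodule.mem_iSup_iff_exists_finset.1 (show w ∈ S from hwS)
  -- A vector of `S` involves only finitely many nonzero eigenvalues, each with a finite-dimensional
  -- eigenspace because `T` is compact.
  refine ⟨⨆ a ∈ t, Module.End.eigenspace T.toLinearMap (a : ℝ), ?_, ?_, w, ht, hws⟩
  · have : ∀ a : {a : ℝ // a ≠ 0}, FiniteDimensional ℝ (Module.End.eigenspace T.toLinearMap (a : ℝ)) :=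
      fun a => ContinuousLinearMap.finite_dimensional_eigenspace hcomp _ a.2
    rw [← Finset.sup_eq_iSup]
    infer_instance
  · intro g w hw
    have : (⨆ a ∈ t, Module.End.eigenspace T.toLinearMap (a : ℝ)) ≤
        (⨆ a ∈ t, Module.End.eigenspace T.toLinearMap (a : ℝ)).comap (U g).toLinearMap := by
      refine iSup₂_le fun a ha v hv => ?_
      refine Submodule.mem_iSup_of_mem a (Submodule.mem_iSup_of_mem ha ?_)
      rw [Module.End.mem_eigenspace_iff] at hv ⊢
      have e1 : T (U g v) = U g (T v) := gramOperator_comm μ U hU hc φ g v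
      have e2 : T v = (a : ℝ) • v := hv
      change T (U g v) = (a : ℝ) • U g v
      rw [e1, e2, map_smul]
    exact this hw

end PeterWeyl

/-! ### The left regular representation on `L²(G)` -/

section Translation

variable {G : Type*} [Group G] [TopologicalSpace G] [IsTopologicalGroup G] [CompactSpace G]
  [SecondCountableTopology G] [T2Space G] [MeasurableSpace G] [BorelSpace G]
  (μ : Measure G) [IsProbabilityMeasure μ] [μ.IsMulLeftInvariant]

/-- The left regular representation of `G` on `L²(G)`. -/
noncomputable def leftTranslation : G →* (Lp ℝ 2 μ →L[ℝ] Lp ℝ 2 μ) where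
  toFun g := LinearIsometry.toContinuousLinearMap
    -- Precomposition reverses products; the inverse turns it into a homomorphism, `(g · w)(x) = w
    -- (g⁻¹ * x)`.
    { toFun := fun w => DomMulAct.mk g⁻¹ • w
      map_add' := smul_add _
      map_smul' := fun r w => smul_comm _ r w
      norm_map' := DomMulAct.norm_smul_Lp _ }
  map_one' := by ext1 w; simp
  map_mul' g h := by ext1 w; simp [mul_smul]

theorem norm_leftTranslation (g : G) (w : Lp ℝ 2 μ) : ‖leftTranslation μ g w‖ = ‖w‖ :=
  DomMulAct.norm_smul_Lp _ _

theorem leftTranslation_ae_eq (g : G) (w : Lp ℝ 2 μ) :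
    leftTranslation μ g w =ᵐ[μ] fun x => w (g⁻¹ * x) :=
  DomMulAct.smul_Lp_ae_eq _ _

theorem continuous_leftTranslation :
    Continuous fun z : G × Lp ℝ 2 μ => leftTranslation μ z.1 z.2 := by
  have : Fact ((2 : ENNReal) ≠ ⊤) := ⟨by simp⟩
  have h : Continuous fun g : G => DomMulAct.mk g⁻¹ := DomMulAct.continuous_mk.comp continuous_inv
  exact (h.comp continuous_fst).smul continuous_snd

theorem continuous_leftTranslation_left (w : Lp ℝ 2 μ) :
    Continuous fun g => leftTranslation μ g w := by
  have : Fact ((2 : ENNReal) ≠ ⊤) := ⟨by simp⟩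
  exact (DomMulAct.continuous_mk.comp continuous_inv).smul continuous_const

theorem leftTranslation_const (g : G) (r : ℝ) :
    leftTranslation μ g (Lp.const 2 μ r) = Lp.const 2 μ r := rfl

attribute [irreducible] leftTranslation

end Translation

/-! ### Integration of continuous functions against `L²` weights -/

section Weighted

variable {α : Type*} [TopologicalSpace α] [CompactSpace α] [SecondCountableTopology α]
  [MeasurableSpace α] [BorelSpace α] (μ : Measure α) [IsProbabilityMeasure μ]
  {P : Type*} [NormedAddCommGroup P] [NormedSpace ℝ P]

theorem integrable_Lp_smul (w : Lp ℝ 2 μ) {F : α → P} (hF : Continuous F) :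
    Integrable (fun g => w g • F g) μ := by
  obtain ⟨C, hC⟩ := isCompact_univ.exists_bound_of_continuousOn hF.continuousOn
  exact ((Lp.memLp w).integrable (by norm_num)).smul_bdd (C := C)
    hF.aestronglyMeasurable (Eventually.of_forall fun x => hC x trivial)

/-- On a probability space the `L¹` norm is at most the `L²` norm. This makes weighted integrals
depend continuously on the weight in `L²`, where the Hilbert space argument takes place. -/
theorem integral_abs_Lp_le (w : Lp ℝ 2 μ) : ∫ g, ‖w g‖ ∂μ ≤ ‖w‖ := by
  rw [Lp.norm_def, integral_norm_eq_lintegral_enorm (Lp.aestronglyMeasurable w),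
    ← eLpNorm_one_eq_lintegral_enorm]
  exact ENNReal.toReal_mono (Lp.eLpNorm_ne_top w)
    (eLpNorm_le_eLpNorm_of_exponent_le (by norm_num) (Lp.aestronglyMeasurable w))

theorem norm_integral_Lp_smul_le (w : Lp ℝ 2 μ) {F : α → P} {C : ℝ} (hF : ∀ g, ‖F g‖ ≤ C) :
    ‖∫ g, w g • F g ∂μ‖ ≤ ‖w‖ * C := by
  have hi : Integrable (fun g => ‖w g‖) μ := ((Lp.memLp w).integrable (by norm_num)).norm
  by_cases hne : Nonempty α
  · have hC : 0 ≤ C := (norm_nonneg _).trans (hF hne.some)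
    calc ‖∫ g, w g • F g ∂μ‖ ≤ ∫ g, ‖w g‖ * C ∂μ :=
          norm_integral_le_of_norm_le (hi.mul_const _) (Eventually.of_forall fun g => by
            rw [norm_smul]; gcongr; exact hF g)
      _ = (∫ g, ‖w g‖ ∂μ) * C := integral_mul_const _ _
      _ ≤ ‖w‖ * C := by gcongr; exact integral_abs_Lp_le μ w
  · exact absurd (nonempty_of_isProbabilityMeasure μ) hne

/-- Integration of a continuous function against an `L²` weight, as a bilinear map. -/
noncomputable def weightedIntegral (P : Type*) [NormedAddCommGroup P] [NormedSpace ℝ P] :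
    Lp ℝ 2 μ →L[ℝ] C(α, P) →L[ℝ] P :=
  LinearMap.mkContinuous₂
    (LinearMap.mk₂ ℝ (fun w F => ∫ g, w g • F g ∂μ)
      (fun w w' F => by
        rw [← integral_add (integrable_Lp_smul μ w F.continuous)
          (integrable_Lp_smul μ w' F.continuous)]
        refine integral_congr_ae ?_
        filter_upwards [Lp.coeFn_add w w'] with g hg
        rw [hg, Pi.add_apply, add_smul])
      (fun r w F => by
        rw [← integral_smul]
        refine integral_congr_ae ?_
        filter_upwards [Lp.coeFn_smul r w] with g hg
        rw [hg, Pi.smul_apply, smul_assoc])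
      (fun w F F' => by
        rw [← integral_add (integrable_Lp_smul μ w F.continuous)
          (integrable_Lp_smul μ w F'.continuous)]
        simp)
      (fun r w F => by
        rw [← integral_smul]
        simp [smul_comm r])) 1
    (fun w F => by
      simpa using norm_integral_Lp_smul_le μ w F.norm_coe_le_norm)

end Weighted

/-! ### Weighted integrals with values in a fiber -/

section FiberIntegral

variable {α : Type*} [TopologicalSpace α] [CompactSpace α] [SecondCountableTopology α]
  [MeasurableSpace α] [BorelSpace α] (μ : Measure α) [IsProbabilityMeasure μ]
  {X : Type*} [TopologicalSpace X] {B : X → Type*}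
  [∀ x, AddCommGroup (B x)] [∀ x, Module ℝ (B x)] [TopologicalSpace (Tot B)]

/-- Continuity of a map on a fiber, for the topology induced from the total space. -/
def FiberContinuous {x : X} {Y : Type*} [TopologicalSpace Y] (l : B x → Y) : Prop :=
  @Continuous (B x) Y (TopologicalSpace.induced (TotalSpace.mk x : B x → Tot B) inferInstance) _ l

theorem FiberContinuous.comp_lift {x : X} {Y : Type*} [TopologicalSpace Y] {l : B x → Y}
    (hl : FiberContinuous l) {Z : Type*} [TopologicalSpace Z] {h : Z → B x}
    (hh : Continuous fun z => (⟨x, h z⟩ : Tot B)) : Continuous fun z => l (h z) := by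
  letI := TopologicalSpace.induced (TotalSpace.mk x : B x → Tot B) inferInstance
  have h1 : Continuous h := continuous_induced_rng.2 hh
  exact Continuous.comp (g := l) hl h1

theorem LinearChart.fiberContinuous {P : Type*} [NormedAddCommGroup P] [NormedSpace ℝ P]
    (c : LinearChart B P) {x : X} (hx : x ∈ c.domain) : FiberContinuous (c.coord x) := by
  letI := TopologicalSpace.induced (TotalSpace.mk x : B x → Tot B) inferInstance
  refine continuous_iff_continuousAt.2 fun b => ?_
  refine (c.continuousAt_iff (q := fun _ : B x => x) (h := id) continuousAt_const hx).1 ?_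
  exact continuous_induced_dom.continuousAt

namespace IsBanachBundle

variable (hB : IsBanachBundle.{p} B)

/-- The integral of a fiber-valued function against an `L²` weight. -/
noncomputable def fiberIntegral (w : Lp ℝ 2 μ) (x : X) (h : α → B x) : B x :=
  letI P := (hB.2 x).choose
  letI : NormedAddCommGroup P := (hB.2 x).choose_spec.choose
  letI : NormedSpace ℝ P := (hB.2 x).choose_spec.choose_spec.choose
  letI c : LinearChart B P := (hB.2 x).choose_spec.choose_spec.choose_spec.choose_spec.choose
  c.symm x (∫ g, w g • c.coord x (h g) ∂μ)

/-- Composed with the inverse of the chosen chart, `l` is a continuous linear map between normed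
spaces and commutes with the Bochner integral. Together with `fiber_ext` this characterizes the
integral independently of the chart used to define it. -/
theorem map_fiberIntegral (w : Lp ℝ 2 μ) {x : X} {h : α → B x}
    (hh : Continuous fun g => (⟨x, h g⟩ : Tot B))
    {Q : Type*} [NormedAddCommGroup Q] [NormedSpace ℝ Q] [CompleteSpace Q] (l : B x →ₗ[ℝ] Q)
    (hl : FiberContinuous l) :
    l (hB.fiberIntegral μ w x h) = ∫ g, w g • l (h g) ∂μ := by
  let P := (hB.2 x).choose
  letI i1 : NormedAddCommGroup P := (hB.2 x).choose_spec.choose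
  letI i2 : NormedSpace ℝ P := (hB.2 x).choose_spec.choose_spec.choose
  letI i3 : CompleteSpace P := (hB.2 x).choose_spec.choose_spec.choose_spec.choose
  let c : LinearChart B P := (hB.2 x).choose_spec.choose_spec.choose_spec.choose_spec.choose
  have hx : x ∈ c.domain := (hB.2 x).choose_spec.choose_spec.choose_spec.choose_spec.choose_spec
  let L : P →L[ℝ] Q := ⟨l ∘ₗ c.symm x, hl.comp_lift (continuous_iff_continuousAt.2 fun p =>
    c.continuousAt_symm (q := fun _ => x) (p := id) continuousAt_const hx continuousAt_id)⟩
  have hc : Continuous fun g => c.coord x (h g) := (c.fiberContinuous hx).comp_lift hh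
  change L (∫ g, w g • c.coord x (h g) ∂μ) = _
  rw [← L.integral_comp_comm (integrable_Lp_smul μ w hc)]
  refine integral_congr_ae (Eventually.of_forall fun g => ?_)
  simp [L, c.symm_coord x hx]

/-- A fiber element is determined by the values of a chart. -/
theorem fiber_ext (hB : IsBanachBundle.{p} B) {x : X} {b b' : B x}
    (h : ∀ (P : Type p) [NormedAddCommGroup P] [NormedSpace ℝ P] [CompleteSpace P]
      (l : B x →ₗ[ℝ] P), FiberContinuous l → l b = l b') : b = b' := by
  obtain ⟨P, _, _, _, c, hc⟩ := hB.2 x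
  exact c.injective_coord hc (h P (c.coord x) (c.fiberContinuous hc))

theorem linearMap_fiberIntegral {X' : Type*} [TopologicalSpace X'] {B' : X' → Type*}
    [∀ x, AddCommGroup (B' x)] [∀ x, Module ℝ (B' x)] [TopologicalSpace (Tot B')]
    (hB' : IsBanachBundle.{p'} B')
    (w : Lp ℝ 2 μ) {x : X} {x' : X'} {h : α → B x}
    (hh : Continuous fun g => (⟨x, h g⟩ : Tot B)) (j : B x →ₗ[ℝ] B' x')
    (hj : FiberContinuous fun b => (⟨x', j b⟩ : Tot B')) :
    j (hB.fiberIntegral μ w x h) = hB'.fiberIntegral μ w x' fun g => j (h g) := by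
  refine hB'.fiber_ext fun P _ _ _ l hl => ?_
  rw [hB'.map_fiberIntegral μ w (hj.comp_lift hh) l hl]
  refine hB.map_fiberIntegral μ w hh (l ∘ₗ j) ?_
  letI := TopologicalSpace.induced (TotalSpace.mk x : B x → Tot B) inferInstance
  exact hl.comp_lift hj

theorem fiberIntegral_add (w : Lp ℝ 2 μ) {x : X} {h k : α → B x}
    (hh : Continuous fun g => (⟨x, h g⟩ : Tot B)) (hk : Continuous fun g => (⟨x, k g⟩ : Tot B)) :
    hB.fiberIntegral μ w x (fun g => h g + k g) =
      hB.fiberIntegral μ w x h + hB.fiberIntegral μ w x k := by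
  refine hB.fiber_ext fun P _ _ _ l hl => ?_
  rw [map_add, hB.map_fiberIntegral μ w hh l hl, hB.map_fiberIntegral μ w hk l hl,
    hB.map_fiberIntegral μ w (hB.continuous_add continuous_const hh hk) l hl,
    ← integral_add (integrable_Lp_smul μ w (hl.comp_lift hh))
      (integrable_Lp_smul μ w (hl.comp_lift hk))]
  simp

theorem fiberIntegral_add_weight (w w' : Lp ℝ 2 μ) {x : X} {h : α → B x}
    (hh : Continuous fun g => (⟨x, h g⟩ : Tot B)) :
    hB.fiberIntegral μ (w + w') x h = hB.fiberIntegral μ w x h + hB.fiberIntegral μ w' x h := by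
  refine hB.fiber_ext fun P _ _ _ l hl => ?_
  have hc := hl.comp_lift hh
  rw [map_add, hB.map_fiberIntegral μ _ hh l hl, hB.map_fiberIntegral μ _ hh l hl,
    hB.map_fiberIntegral μ _ hh l hl]
  exact congrArg (· ⟨_, hc⟩) (map_add (weightedIntegral μ P) w w')

theorem fiberIntegral_smul_weight (r : ℝ) (w : Lp ℝ 2 μ) {x : X} {h : α → B x}
    (hh : Continuous fun g => (⟨x, h g⟩ : Tot B)) :
    hB.fiberIntegral μ (r • w) x h = r • hB.fiberIntegral μ w x h := by
  refine hB.fiber_ext fun P _ _ _ l hl => ?_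
  have hc := hl.comp_lift hh
  rw [map_smul, hB.map_fiberIntegral μ _ hh l hl, hB.map_fiberIntegral μ _ hh l hl]
  exact congrArg (· ⟨_, hc⟩) (map_smul (weightedIntegral μ P) r w)

theorem fiberIntegral_one_const {x : X} (b : B x) :
    hB.fiberIntegral μ (Lp.const 2 μ (1 : ℝ)) x (fun _ => b) = b := by
  refine hB.fiber_ext fun P _ _ _ l hl => ?_
  rw [hB.map_fiberIntegral μ _ continuous_const l hl]
  simp

/-- In a chart, joint continuity on `V × α` curries to continuity of `V → C(α, P)` for the uniform
norm, as `α` is compact; then the bounded bilinear `weightedIntegral` applies. -/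
theorem continuous_fiberIntegral {Z : Type*} [TopologicalSpace Z] {q : Z → X} (hq : Continuous q)
    {h : ∀ z, α → B (q z)} (hh : Continuous fun z : Z × α => (⟨q z.1, h z.1 z.2⟩ : Tot B)) :
    Continuous fun z : Lp ℝ 2 μ × Z =>
      (⟨q z.2, hB.fiberIntegral μ z.1 (q z.2) (h z.2)⟩ : Tot B) := by
  refine continuous_iff_continuousAt.2 fun ⟨w₀, z₀⟩ => ?_
  obtain ⟨P, _, _, _, c, hc⟩ := hB.2 (q z₀)
  rw [c.continuousAt_iff (q := fun z : Lp ℝ 2 μ × Z => q z.2) (by fun_prop) hc]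
  let V : Set Z := q ⁻¹' c.domain
  have hV : IsOpen V := c.isOpen_domain.preimage hq
  let Φ₀ : C(V × α, P) := ⟨fun z => c.coord (q z.1) (h z.1 z.2), by
    refine continuous_iff_continuousAt.2 fun z => ?_
    refine (c.continuousAt_iff (q := fun z : V × α => q z.1) (h := fun z => h z.1 z.2)
      (by fun_prop) z.1.2).1 ?_
    have : Continuous fun z : V × α => (z.1.1, z.2) := by fun_prop
    exact (hh.comp this).continuousAt⟩
  let Φ : C(V, C(α, P)) := Φ₀.curry
  have h1 : Continuous fun z : Lp ℝ 2 μ × V => weightedIntegral μ P z.1 (Φ z.2) := by fun_prop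
  have h2 : (fun z : Lp ℝ 2 μ × V => weightedIntegral μ P z.1 (Φ z.2)) =
      fun z => c.coord (q z.2) (hB.fiberIntegral μ z.1 (q z.2) (h z.2)) := by
    ext ⟨w, z⟩
    have hz : Continuous fun g => (⟨q z, h z g⟩ : Tot B) :=
      hh.comp (Continuous.prodMk_right (z : Z))
    rw [hB.map_fiberIntegral μ w hz _ (c.fiberContinuous z.2)]
    rfl
  rw [h2] at h1
  have h3 : Topology.IsOpenEmbedding fun z : Lp ℝ 2 μ × V => (z.1, (z.2 : Z)) :=
    Topology.IsOpenEmbedding.id.prodMap hV.isOpenEmbedding_subtypeVal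
  exact (h3.continuousAt_iff (x := (w₀, ⟨z₀, hc⟩))).1 h1.continuousAt

theorem fiberIntegral_leftTranslation {G : Type*} [Group G] [TopologicalSpace G]
    [IsTopologicalGroup G] [CompactSpace G] [SecondCountableTopology G] [T2Space G]
    [MeasurableSpace G] [BorelSpace G] (μ : Measure G) [IsProbabilityMeasure μ]
    [μ.IsMulLeftInvariant] (k : G) (w : Lp ℝ 2 μ) {x : X} {h : G → B x}
    (hh : Continuous fun g => (⟨x, h g⟩ : Tot B)) :
    hB.fiberIntegral μ (leftTranslation μ k w) x h =
      hB.fiberIntegral μ w x fun g => h (k * g) := by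
  refine hB.fiber_ext fun P _ _ _ l hl => ?_
  rw [hB.map_fiberIntegral μ _ hh l hl,
    hB.map_fiberIntegral μ _ (hh.comp (continuous_const_mul k)) l hl,
    ← integral_mul_left_eq_self (μ := μ) (fun g => (leftTranslation μ k w) g • _) k]
  have h4 : (fun g => leftTranslation μ k w (k * g)) =ᵐ[μ] fun g => w (k⁻¹ * (k * g)) :=
    (measurePreserving_mul_left μ k).quasiMeasurePreserving.ae_eq_comp (leftTranslation_ae_eq μ k w)
  refine integral_congr_ae ?_
  filter_upwards [h4] with g hg
  rw [hg, inv_mul_cancel_left]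

end IsBanachBundle

end FiberIntegral

/-! ### Banach modules: stability of surjections onto projective modules -/

section BanachModule

variable {A : Type*} [NormedRing A] [NormedAlgebra ℝ A]
  {P : Type*} [NormedAddCommGroup P] [NormedSpace ℝ P] [Module A P] [IsScalarTower ℝ A P]
  [ContinuousSMul A P]

variable (A P) in
-- Only joint continuity of the action is assumed. Continuity at the origin bounds `a • p` by `1` on
-- a `δ`-ball; rescaling both factors to norm `δ / 2` produces the constant `(2 / δ)²`.
theorem exists_norm_smul_le : ∃ C, ∀ (a : A) (p : P), ‖a • p‖ ≤ C * ‖a‖ * ‖p‖ := by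
  have hA : SMulCommClass ℝ A P := IsScalarTower.to_smulCommClass
  have h0 : Tendsto (fun z : A × P => z.1 • z.2) (𝓝 (0, 0)) (𝓝 0) := by
    have : Continuous fun z : A × P => z.1 • z.2 := continuous_smul
    simpa using this.tendsto (0, 0)
  obtain ⟨δ, hδ, h⟩ := Metric.eventually_nhds_iff_ball.1
    (h0.eventually (Metric.ball_mem_nhds (0 : P) one_pos))
  have h' : ∀ (a : A) (p : P), ‖a‖ < δ → ‖p‖ < δ → ‖a • p‖ ≤ 1 := fun a p ha hp => by
    simpa using (h (a, p) (by simp [Prod.dist_eq, ha, hp])).le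
  refine ⟨(2 / δ) * (2 / δ), fun a p => ?_⟩
  rcases eq_or_ne a 0 with rfl | ha
  · simp
  rcases eq_or_ne p 0 with rfl | hp
  · simp
  have ha' : 0 < ‖a‖ := norm_pos_iff.2 ha
  have hp' : 0 < ‖p‖ := norm_pos_iff.2 hp
  have key := h' ((δ / 2 / ‖a‖) • a) ((δ / 2 / ‖p‖) • p)
    (by rw [norm_smul, Real.norm_of_nonneg (by positivity), div_mul_cancel₀ _ ha'.ne']; linarith)
    (by rw [norm_smul, Real.norm_of_nonneg (by positivity), div_mul_cancel₀ _ hp'.ne']; linarith)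
  rw [smul_assoc, smul_comm a, smul_smul, norm_smul, Real.norm_of_nonneg (by positivity)] at key
  have : ‖a • p‖ = (2 / δ * (2 / δ) * ‖a‖ * ‖p‖) * (δ / 2 / ‖a‖ * (δ / 2 / ‖p‖) * ‖a • p‖) := by
    field_simp
  rw [this]
  exact mul_le_of_le_one_right (by positivity) key

variable (A P) in
/-- Scalar multiplication of a Banach module, as a bilinear map. -/
noncomputable def smulBilin : P →L[ℝ] A →L[ℝ] P :=
  haveI : SMulCommClass ℝ A P := IsScalarTower.to_smulCommClass
  LinearMap.mkContinuous₂
    (LinearMap.mk₂ ℝ (fun p a => a • p) (fun _ _ _ => smul_add _ _ _)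
      (fun r p a => smul_comm a r p) (fun _ _ _ => add_smul _ _ _) (fun r p a => smul_assoc r a p))
    (exists_norm_smul_le A P).choose
    (fun p a => ((exists_norm_smul_le A P).choose_spec a p).trans_eq (by ring))

theorem smulBilin_apply (p : P) (a : A) : smulBilin A P p a = a • p := rfl

variable {ι : Type*} [Fintype ι]

variable (A) in
/-- The map `A^ι → P` given by a finite family of elements of `P`. -/
noncomputable def combination (s : ι → P) : (ι → A) →L[ℝ] P :=
  ∑ i, (smulBilin A P (s i)).comp (ContinuousLinearMap.proj i)

variable (A P ι) in
-- Continuity is for the operator norm, not just pointwise. This is what brings openness of the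
-- invertible operators into play, although bundle charts are only strongly continuous.
theorem continuous_combination :
    Continuous fun s : ι → P => (combination A s : (ι → A) →L[ℝ] P) := by
  unfold combination
  fun_prop

theorem combination_apply (s : ι → P) (a : ι → A) : combination A s a = ∑ i, a i • s i := by
  simp [combination, smulBilin_apply, sum_apply]

theorem combination_smul (s : ι → P) (b : A) (a : ι → A) :
    combination A s (b • a) = b • combination A s a := by
  simp [combination_apply, Finset.smul_sum, mul_smul]

theorem surjective_combination_iff (s : ι → P) :
    Function.Surjective (combination A s) ↔ Submodule.span A (range s) = ⊤ := by
  rw [Submodule.eq_top_iff']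
  refine forall_congr' fun p => ?_
  rw [Submodule.mem_span_range_iff_exists_fun]
  simp [combination_apply]

set_option synthInstance.maxHeartbeats 200000 in
/-- A surjection from a finite free Banach module to a projective one can be completed to an
isomorphism, and remains so completed under small perturbations. -/
theorem exists_splitting [CompleteSpace A] [CompleteSpace P] [Module.Projective A P]
    {s₀ : ι → P} (hs₀ : Submodule.span A (range s₀) = ⊤) :
    ∃ (K : Submodule A (ι → A)) (_ : IsClosed (K : Set (ι → A))) (κ : (ι → A) →L[ℝ] K),
      (∀ (a : A) q, κ (a • q) = a • κ q) ∧
      ∃ V : Set (ι → P), IsOpen V ∧ s₀ ∈ V ∧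
        ∃ r : (ι → P) → (P × K →L[ℝ] (ι → A)), ContinuousOn r V ∧
          (∀ s ∈ V, ∀ z, (combination A s (r s z), κ (r s z)) = z) ∧
          ∀ s ∈ V, ∀ q, r s (combination A s q, κ q) = q := by
  let pr : (ι → A) →ₗ[A] P :=
    { toFun := combination A s₀
      map_add' := map_add _
      map_smul' := combination_smul s₀ }
  have hpr : Function.Surjective pr := (surjective_combination_iff s₀).2 hs₀
  obtain ⟨τ, hτ⟩ := Module.projective_lifting_property pr LinearMap.id hpr
  have hτ' : ∀ p, pr (τ p) = p := fun p => LinearMap.congr_fun hτ p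
  let K := LinearMap.ker pr
  have hK : IsClosed (K : Set (ι → A)) := (combination A s₀).isClosed_ker
  have hKc : CompleteSpace K := hK.completeSpace_coe
  let κ₀ : (ι → A) →ₗ[A] K := LinearMap.codRestrict K (LinearMap.id - τ ∘ₗ pr) fun q => by
    simp [K, hτ']
  -- An `A`-linear map out of a finite free module is automatically continuous, so the algebraic
  -- lifting `τ` needs no topological input.
  have hκ₀ : Continuous κ₀ := LinearMap.continuous_on_pi κ₀
  let κ : (ι → A) →L[ℝ] K := ⟨κ₀.restrictScalars ℝ, hκ₀⟩
  have hκ : ∀ q, (κ q : ι → A) = q - τ (pr q) := fun q => rfl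
  have hbij : LinearMap.ker ((combination A s₀).prod κ).toLinearMap = ⊥ ∧
      LinearMap.range ((combination A s₀).prod κ).toLinearMap = ⊤ := by
    constructor
    · rw [LinearMap.ker_eq_bot']
      intro q hq
      obtain ⟨h1, h2⟩ := Prod.ext_iff.1 hq
      have h1 : pr q = 0 := h1
      have h2 : (κ q : ι → A) = 0 := congrArg Subtype.val h2
      rwa [hκ, h1, map_zero, sub_zero] at h2
    · rw [LinearMap.range_eq_top]
      rintro ⟨p, k⟩
      have hk : pr k = 0 := k.2
      refine ⟨τ p + k, Prod.ext ?_ (Subtype.ext ?_)⟩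
      · change pr (τ p + k) = p
        rw [map_add, hτ', hk, add_zero]
      · change (κ (τ p + k) : ι → A) = k
        rw [hκ, map_add, hτ', hk, add_zero, add_sub_cancel_left]
  -- Open mapping theorem; this is where completeness of `A`, `P` and `K` enters.
  let e₀ : (ι → A) ≃L[ℝ] P × K := ContinuousLinearEquiv.ofBijective _ hbij.1 hbij.2
  let Λ : (ι → P) → (ι → A) →L[ℝ] P × K := fun s => (combination A s).prod κ
  have hΛ : Continuous Λ := by
    have h1 := continuous_combination A P ι
    have : Λ = fun s => (ContinuousLinearMap.inl ℝ P K).comp (combination A s) +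
        (ContinuousLinearMap.inr ℝ P K).comp κ := by
      ext s q <;> simp [Λ]
    rw [this]
    exact (continuous_const.clm_comp h1).add continuous_const
  -- `V` is the preimage of the open set of invertible operators, and `r` is operator inversion,
  -- which is continuous there. `K` and `κ` do not move with `s`.
  refine ⟨K, hK, κ, map_smul κ₀, Λ ⁻¹' range ((↑) : ((ι → A) ≃L[ℝ] P × K) → _),
    ContinuousLinearEquiv.isOpen.preimage hΛ, ⟨e₀, rfl⟩, fun s => (Λ s).inverse, ?_, ?_, ?_⟩
  · rintro s ⟨e, he⟩
    have : ContinuousAt ContinuousLinearMap.inverse (Λ s) := by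
      rw [← he]
      exact (contDiffAt_map_inverse (𝕜 := ℝ) (n := 0) e).continuousAt
    exact (this.comp hΛ.continuousAt).continuousWithinAt
  · rintro s ⟨e, he⟩ z
    change Λ s ((Λ s).inverse z) = z
    rw [← he, ContinuousLinearMap.inverse_equiv]
    exact e.apply_symm_apply z
  · rintro s ⟨e, he⟩ q
    change (Λ s).inverse (Λ s q) = q
    rw [← he, ContinuousLinearMap.inverse_equiv]
    exact e.symm_apply_apply q

theorem eventually_span_eq_top [CompleteSpace A] [CompleteSpace P] [Module.Projective A P]
    {s₀ : ι → P} (hs₀ : Submodule.span A (range s₀) = ⊤) :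
    ∀ᶠ s in 𝓝 s₀, Submodule.span A (range s) = ⊤ := by
  obtain ⟨K, hK, κ, -, V, hV, hs, r, -, hr, -⟩ := exists_splitting hs₀
  filter_upwards [hV.mem_nhds hs] with s hs
  rw [← surjective_combination_iff]
  exact fun p => ⟨r s (p, 0), congrArg Prod.fst (hr s hs (p, 0))⟩

end BanachModule

/-! ### Charts of algebra and module bundles; transport between fibers -/

section GBundles

variable {G : Type*} [Group G] [TopologicalSpace G]
  {X : Type*} [TopologicalSpace X] [MulAction G X]
  {A : Type uA} [NormedRing A] [NormedAlgebra ℝ A]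

namespace GAlgebraBundle

variable (𝒜 : GAlgebraBundle.{v} G X A)

/-- A chart of `𝒜` which is an isomorphism of algebras on each fiber. -/
def IsAlgebraChart (a : LinearChart 𝒜.Fiber A) : Prop :=
  ∀ y ∈ a.domain, ∃ f : 𝒜.Fiber y ≃ₐ[ℝ] A, ∀ b, a.coord y b = f b

variable {𝒜} in
theorem isAlgebraChart_ofTrivialization
    (e : Trivialization A (TotalSpace.proj : Tot 𝒜.Fiber → X)) {U : Set X} (hU : IsOpen U)
    (hUe : U ⊆ e.baseSet) (he : IsAlgebraTrivialization 𝒜.Fiber e) :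
    𝒜.IsAlgebraChart (LinearChart.ofTrivialization e hU hUe fun y hy =>
      ⟨(he y (hUe hy)).choose.toLinearEquiv, fun s => (he y (hUe hy)).choose_spec s⟩) := by
  intro y hy
  obtain ⟨f, hf⟩ := he y (hUe hy)
  exact ⟨f, fun b => (LinearChart.coord_ofTrivialization _ _ _ _ hy b).trans (hf b)⟩

theorem exists_algebraChart (x : X) :
    ∃ a : LinearChart 𝒜.Fiber A, x ∈ a.domain ∧ 𝒜.IsAlgebraChart a := by
  obtain ⟨e, hx, he⟩ := 𝒜.locally_trivial x
  exact ⟨_, hx, isAlgebraChart_ofTrivialization e e.open_baseSet subset_rfl he⟩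

theorem continuous_proj : Continuous (TotalSpace.proj : Tot 𝒜.Fiber → X) := by
  refine continuous_iff_continuousAt.2 fun p => ?_
  obtain ⟨e, hx, he⟩ := 𝒜.locally_trivial p.proj
  exact e.continuousAt_proj (e.mem_source.2 hx)

theorem isBanachBundle [CompleteSpace A] : IsBanachBundle.{uA} 𝒜.Fiber :=
  ⟨𝒜.continuous_proj, fun x =>
    ⟨A, inferInstance, inferInstance, inferInstance, (𝒜.exists_algebraChart x).choose,
      (𝒜.exists_algebraChart x).choose_spec.1⟩⟩

theorem continuous_mul {Z : Type*} [TopologicalSpace Z] {q : Z → X} (hq : Continuous q)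
    {h k : ∀ z, 𝒜.Fiber (q z)} (hh : Continuous fun z => (⟨q z, h z⟩ : Tot 𝒜.Fiber))
    (hk : Continuous fun z => (⟨q z, k z⟩ : Tot 𝒜.Fiber)) :
    Continuous fun z => (⟨q z, h z * k z⟩ : Tot 𝒜.Fiber) := by
  refine continuous_iff_continuousAt.2 fun z₀ => ?_
  obtain ⟨a, ha, halg⟩ := 𝒜.exists_algebraChart (q z₀)
  rw [a.continuousAt_iff hq.continuousAt ha]
  refine (((a.continuousAt_iff hq.continuousAt ha).1 hh.continuousAt).mul
    ((a.continuousAt_iff hq.continuousAt ha).1 hk.continuousAt)).congr ?_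
  filter_upwards [hq.continuousAt (a.isOpen_domain.mem_nhds ha)] with z hz
  obtain ⟨f, hf⟩ := halg _ hz
  simp [hf]

/-- The action of `g` as a map between the fibers over `x` and `y = g • x`. -/
def actTo (g : G) {x y : X} (h : g • x = y) : 𝒜.Fiber x ≃ₐ[ℝ] 𝒜.Fiber y :=
  Eq.rec (motive := fun y _ => 𝒜.Fiber x ≃ₐ[ℝ] 𝒜.Fiber y) (𝒜.act g x) h

/-- Elements of fibers over points that are only provably equal are compared inside the total space.
-/
theorem mk_actTo (g : G) {x y : X} (h : g • x = y) (a : 𝒜.Fiber x) :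
    (⟨y, 𝒜.actTo g h a⟩ : Tot 𝒜.Fiber) = ⟨g • x, 𝒜.act g x a⟩ := by
  subst h; rfl

theorem actTo_actTo (g k : G) {x y z : X} (h : k • x = y) (h' : g • y = z) (h'' : (g * k) • x = z)
    (a : 𝒜.Fiber x) : 𝒜.actTo g h' (𝒜.actTo k h a) = 𝒜.actTo (g * k) h'' a := by
  apply TotalSpace.mk_injective
  rw [mk_actTo, mk_actTo, 𝒜.act_mul]
  subst h
  rfl

theorem actTo_one {x : X} (h : (1 : G) • x = x) (a : 𝒜.Fiber x) : 𝒜.actTo 1 h a = a := by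
  apply TotalSpace.mk_injective
  rw [mk_actTo, 𝒜.act_one]

end GAlgebraBundle

namespace GModuleFamily

variable {𝒜 : GAlgebraBundle.{v} G X A}

/-- The real vector space structure on the fibers of `E`. -/
noncomputable instance realModule (E : GModuleFamily.{v, w} 𝒜) (x : X) : Module ℝ (E.Fiber x) :=
  Module.compHom _ (algebraMap ℝ (𝒜.Fiber x))

instance (E : GModuleFamily.{v, w} 𝒜) (x : X) : IsScalarTower ℝ (𝒜.Fiber x) (E.Fiber x) where
  smul_assoc r a s := by
    rw [Algebra.smul_def, mul_smul]; rfl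

theorem real_smul_def (E : GModuleFamily.{v, w} 𝒜) {x : X} (r : ℝ) (s : E.Fiber x) :
    r • s = algebraMap ℝ (𝒜.Fiber x) r • s := rfl

instance (E : GModuleFamily.{v, w} 𝒜) (x : X) : SMulCommClass ℝ (𝒜.Fiber x) (E.Fiber x) :=
  IsScalarTower.to_smulCommClass

instance (E : GModuleFamily.{v, w} 𝒜) (x : X) : SMulCommClass (𝒜.Fiber x) ℝ (E.Fiber x) :=
  SMulCommClass.symm _ _ _

/-- The action of `g` as a map between the fibers over `x` and `y = g • x`. -/
def actTo (E : GModuleFamily.{v, w} 𝒜) (g : G) {x y : X} (h : g • x = y) :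
    E.Fiber x →+ E.Fiber y :=
  Eq.rec (motive := fun y _ => E.Fiber x →+ E.Fiber y) (E.act g x) h

theorem mk_actTo (E : GModuleFamily.{v, w} 𝒜) (g : G) {x y : X} (h : g • x = y) (a : E.Fiber x) :
    (⟨y, E.actTo g h a⟩ : Tot E.Fiber) = ⟨g • x, E.act g x a⟩ := by
  subst h; rfl

theorem actTo_rfl (E : GModuleFamily.{v, w} 𝒜) (g : G) (x : X) (a : E.Fiber x) :
    E.actTo g (rfl : g • x = g • x) a = E.act g x a := rfl

/-- A chart of `E` with model the Banach `A`-module `P`, together with a compatible chart of `𝒜`. -/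
structure ModuleChart (E : GModuleFamily.{v, w} 𝒜) (P : Type*) [NormedAddCommGroup P]
    [NormedSpace ℝ P] [Module A P] extends LinearChart E.Fiber P where
  base : LinearChart 𝒜.Fiber A
  isAlgebraChart : 𝒜.IsAlgebraChart base
  domain_subset : domain ⊆ base.domain
  coord_smul : ∀ y ∈ domain, ∀ a s, coord y (a • s) = base.coord y a • coord y s

namespace ModuleChart

variable {E : GModuleFamily.{v, w} 𝒜} {P : Type*} [NormedAddCommGroup P]
    [NormedSpace ℝ P] [Module A P]

/-- A chart is bijective and semilinear over an algebra isomorphism, so generation can be tested in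
the fixed module `P`, where it is an open condition. -/
theorem span_eq_top_iff (c : E.ModuleChart P) {y : X} (hy : y ∈ c.domain) {ι : Type*} [Fintype ι]
    (s : ι → E.Fiber y) :
    Submodule.span (𝒜.Fiber y) (range s) = ⊤ ↔
      Submodule.span A (range fun i => c.coord y (s i)) = ⊤ := by
  simp only [Submodule.eq_top_iff', Submodule.mem_span_range_iff_exists_fun]
  have hb := c.domain_subset hy
  constructor
  · intro h p
    obtain ⟨a, ha⟩ := h (c.symm y p)
    refine ⟨fun i => c.base.coord y (a i), ?_⟩
    have := congrArg (c.coord y) ha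
    rw [map_sum, c.coord_symm y hy] at this
    simpa [c.coord_smul y hy] using this
  · intro h e
    obtain ⟨a, ha⟩ := h (c.coord y e)
    refine ⟨fun i => c.base.symm y (a i), c.injective_coord hy ?_⟩
    rw [map_sum, ← ha]
    simp [c.coord_smul y hy, c.base.coord_symm y hb]

theorem projective (c : E.ModuleChart P) {y : X} (hy : y ∈ c.domain)
    [Module.Projective (𝒜.Fiber y) (E.Fiber y)] : Module.Projective A P := by
  obtain ⟨f, hf⟩ := c.isAlgebraChart y (c.domain_subset hy)
  letI := RingHomInvPair.of_ringEquiv f.toRingEquiv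
  letI := (RingHomInvPair.of_ringEquiv f.toRingEquiv).symm
  let e : E.Fiber y ≃ₛₗ[(f.toRingEquiv : 𝒜.Fiber y →+* A)] P :=
    { toFun := c.coord y
      invFun := c.symm y
      left_inv := c.symm_coord y hy
      right_inv := c.coord_symm y hy
      map_add' := map_add _
      map_smul' := fun a s => by rw [c.coord_smul y hy, hf]; rfl }
  exact Module.Projective.of_equiv e

theorem symm_smul (c : E.ModuleChart P) {y : X} (hy : y ∈ c.domain) (a : 𝒜.Fiber y) (p : P) :
    c.symm y (c.base.coord y a • p) = a • c.symm y p := by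
  apply c.injective_coord hy
  rw [c.coord_smul y hy, c.coord_symm y hy, c.coord_symm y hy]

end ModuleChart

/-- Trivializations are only assumed additive and compatible with the algebra. Real linearity
follows because real scalars act through `algebraMap`, which algebra isomorphisms preserve. -/
theorem IsLocallyTrivial.exists_moduleChart {E : GModuleFamily.{v, w} 𝒜} (hE : E.IsLocallyTrivial)
    (x : X) :
    ∃ (P : Type w) (_ : NormedAddCommGroup P) (_ : NormedSpace ℝ P) (_ : CompleteSpace P)
      (_ : Module A P) (_ : IsScalarTower ℝ A P) (_ : ContinuousSMul A P) (c : E.ModuleChart P),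
      x ∈ c.domain := by
  obtain ⟨P, _, _, _, _, _, _, e, ε, hxe, hxε, he, h⟩ := hE x
  have hlin : ∀ y ∈ e.baseSet ∩ ε.baseSet, ∃ f : E.Fiber y ≃ₗ[ℝ] P,
      ∀ s, (ε ⟨y, s⟩).2 = f s := by
    intro y hy
    obtain ⟨f, hf⟩ := he y hy.1
    obtain ⟨hadd, hsmul⟩ := h y hy
    let l : E.Fiber y →ₗ[ℝ] P :=
      { toFun := fun s => (ε ⟨y, s⟩).2
        map_add' := hadd
        map_smul' := fun r s => by
          rw [real_smul_def, hsmul, hf, AlgEquiv.commutes, algebraMap_smul]; rfl }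
    refine ⟨LinearEquiv.ofBijective l ⟨fun s t hst => ?_, fun p => ?_⟩, fun s => rfl⟩
    · have h1 : ε ⟨y, s⟩ = ε ⟨y, t⟩ := by
        refine Prod.ext ?_ hst
        rw [ε.coe_fst (ε.mem_source.2 hy.2), ε.coe_fst (ε.mem_source.2 hy.2)]
      exact TotalSpace.mk_injective y
        (ε.injOn (ε.mem_source.2 hy.2) (ε.mem_source.2 hy.2) h1)
    · obtain ⟨t, ht, hεt⟩ : ∃ t : Tot E.Fiber, t.proj = y ∧ ε t = (y, p) :=
        ⟨_, ε.proj_symm_apply' hy.2, ε.apply_symm_apply' hy.2⟩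
      subst ht
      exact ⟨t.snd, congrArg Prod.snd hεt⟩
  have hU : IsOpen (e.baseSet ∩ ε.baseSet) := e.open_baseSet.inter ε.open_baseSet
  refine ⟨P, _, _, ‹_›, _, ‹_›, ‹_›,
    { toLinearChart := LinearChart.ofTrivialization ε hU inter_subset_right hlin
      base := LinearChart.ofTrivialization e hU inter_subset_left _
      isAlgebraChart := GAlgebraBundle.isAlgebraChart_ofTrivialization e hU inter_subset_left he
      domain_subset := subset_rfl
      coord_smul := fun y hy a s => ?_ }, ⟨hxe, hxε⟩⟩
  have hy : y ∈ e.baseSet ∩ ε.baseSet := hy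
  rw [LinearChart.coord_ofTrivialization _ _ _ _ hy, LinearChart.coord_ofTrivialization _ _ _ _ hy,
    LinearChart.coord_ofTrivialization _ _ _ _ hy, (h y hy).2]

namespace IsGBundle

variable {E : GModuleFamily.{v, w} 𝒜} (hE : E.IsGBundle)

theorem continuous_proj (hE : E.IsGBundle) :
    Continuous (TotalSpace.proj : Tot E.Fiber → X) := by
  refine continuous_iff_continuousAt.2 fun p => ?_
  obtain ⟨P, _, _, _, _, _, _, e, ε, -, hx, -⟩ := hE.locally_trivial p.proj
  exact ε.continuousAt_proj (ε.mem_source.2 hx)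

theorem isBanachBundle (hE : E.IsGBundle) : IsBanachBundle.{w} E.Fiber := by
  refine ⟨hE.continuous_proj, fun x => ?_⟩
  obtain ⟨P, i1, i2, i3, _, _, _, c, hx⟩ := hE.locally_trivial.exists_moduleChart x
  exact ⟨P, i1, i2, i3, c.toLinearChart, hx⟩

theorem continuous_smul_lift (hE : E.IsGBundle) {Z : Type*} [TopologicalSpace Z] {q : Z → X}
    {a : ∀ z, 𝒜.Fiber (q z)} (ha : Continuous fun z => (⟨q z, a z⟩ : Tot 𝒜.Fiber))
    {s : ∀ z, E.Fiber (q z)} (hs : Continuous fun z => (⟨q z, s z⟩ : Tot E.Fiber)) :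
    Continuous fun z => (⟨q z, a z • s z⟩ : Tot E.Fiber) := by
  letI := fiberProductTopology 𝒜.Fiber E.Fiber
  have h1 : Continuous fun z => (⟨q z, (a z, s z)⟩ : Tot fun x => 𝒜.Fiber x × E.Fiber x) :=
    continuous_induced_rng.2 (ha.prodMk hs)
  exact hE.continuous_smul.comp h1

theorem actTo_actTo (hE : E.IsGBundle) (g k : G) {x y z : X} (h : k • x = y) (h' : g • y = z)
    (h'' : (g * k) • x = z) (s : E.Fiber x) :
    E.actTo g h' (E.actTo k h s) = E.actTo (g * k) h'' s := by
  apply TotalSpace.mk_injective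
  rw [mk_actTo, mk_actTo, hE.act_mul]
  subst h
  rfl

theorem actTo_one (hE : E.IsGBundle) {x : X} (h : (1 : G) • x = x) (s : E.Fiber x) :
    E.actTo 1 h s = s := by
  apply TotalSpace.mk_injective
  rw [mk_actTo, hE.act_one]

theorem actTo_smul (hE : E.IsGBundle) (g : G) {x y : X} (h : g • x = y) (a : 𝒜.Fiber x)
    (s : E.Fiber x) : E.actTo g h (a • s) = 𝒜.actTo g h a • E.actTo g h s := by
  subst h
  exact hE.act_smul g x a s

theorem continuous_actTo (hE : E.IsGBundle) {Z : Type*} [TopologicalSpace Z] {q q' : Z → X}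
    {γ : Z → G} (hγ : Continuous γ) (h : ∀ z, γ z • q z = q' z) {s : ∀ z, E.Fiber (q z)}
    (hs : Continuous fun z => (⟨q z, s z⟩ : Tot E.Fiber)) :
    Continuous fun z => (⟨q' z, E.actTo (γ z) (h z) (s z)⟩ : Tot E.Fiber) := by
  simp only [mk_actTo]
  exact hE.continuous_act.comp (hγ.prodMk hs)

/-- The action between fibers as a real linear map. -/
def actLinear (hE : E.IsGBundle) (g : G) {x y : X} (h : g • x = y) :
    E.Fiber x →ₗ[ℝ] E.Fiber y where
  toFun := E.actTo g h
  map_add' := map_add _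
  map_smul' r s := by
    rw [real_smul_def, hE.actTo_smul, AlgEquiv.commutes]; rfl

theorem actLinear_apply (hE : E.IsGBundle) (g : G) {x y : X} (h : g • x = y) (s : E.Fiber x) :
    hE.actLinear g h s = E.actTo g h s := rfl

theorem fiberContinuous_actLinear (hE : E.IsGBundle) (g : G) {x y : X} (h : g • x = y) :
    FiberContinuous fun s => (⟨y, hE.actLinear g h s⟩ : Tot E.Fiber) := by
  letI := TopologicalSpace.induced (TotalSpace.mk x : E.Fiber x → Tot E.Fiber) inferInstance
  exact hE.continuous_actTo (Z := E.Fiber x) (q := fun _ => x) (q' := fun _ => y)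
    (γ := fun _ => g) continuous_const (fun _ => h) (s := id) continuous_induced_dom

end IsGBundle

end GModuleFamily

end GBundles

theorem exists_bump {X : Type*} [TopologicalSpace X] [CompactSpace X] [T2Space X] {x : X}
    {U : Set X} (hU : U ∈ 𝓝 x) :
    ∃ χ : C(X, ℝ), tsupport χ ⊆ U ∧ (∀ᶠ y in 𝓝 x, χ y = 1) ∧ ∀ y, 0 ≤ χ y := by
  obtain ⟨V, hV, hVc, hVU⟩ := exists_mem_nhds_isClosed_subset (interior_mem_nhds.2 hU)
  obtain ⟨χ, h1, h2, h3⟩ := exists_tsupport_one_of_isOpen_isClosed isOpen_interior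
    isClosed_closure.isCompact hVc hVU
  refine ⟨χ, h1.trans interior_subset, ?_, fun y => (h3 y).1⟩
  filter_upwards [hV] with y hy using h2 hy

/-! ### Generating sections and their averages over the group -/

section Sections

variable {G : Type*} [Group G] [TopologicalSpace G] [IsTopologicalGroup G]
  {X : Type*} [TopologicalSpace X] [MulAction G X] [ContinuousSMul G X]
  {A : Type uA} [NormedRing A] [NormedAlgebra ℝ A]
  {𝒜 : GAlgebraBundle.{v} G X A}

namespace GModuleFamily

/-- The action of `g` on sections of `E`. -/
def translate (E : GModuleFamily.{v, w} 𝒜) (g : G) (s : ∀ x, E.Fiber x) (x : X) : E.Fiber x :=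
  E.actTo g (smul_inv_smul g x) (s (g⁻¹ • x))

theorem translate_eq (E : GModuleFamily.{v, w} 𝒜) (g : G) (s : ∀ x, E.Fiber x) {x y : X}
    (h : g • y = x) : E.translate g s x = E.actTo g h (s y) := by
  have : y = g⁻¹ • x := by rw [← h, inv_smul_smul]
  subst this
  rfl

namespace IsGBundle

variable {E : GModuleFamily.{v, w} 𝒜} (hE : E.IsGBundle)

theorem translate_one (hE : E.IsGBundle) (s : ∀ x, E.Fiber x) (x : X) :
    E.translate 1 s x = s x := by
  rw [E.translate_eq 1 s (one_smul G x), hE.actTo_one]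

theorem actTo_translate (hE : E.IsGBundle) (k g : G) (s : ∀ x, E.Fiber x) {x y : X}
    (h : k • x = y) : E.actTo k h (E.translate g s x) = E.translate (k * g) s y := by
  rw [translate, hE.actTo_actTo k g _ h (by rw [mul_smul, smul_inv_smul, h])]
  exact (E.translate_eq _ _ _).symm

theorem continuous_translate (hE : E.IsGBundle) {s : ∀ x, E.Fiber x}
    (hs : Continuous fun x => (⟨x, s x⟩ : Tot E.Fiber)) :
    Continuous fun z : X × G => (⟨z.1, E.translate z.2 s z.1⟩ : Tot E.Fiber) :=
  hE.continuous_actTo (q := fun z : X × G => z.2⁻¹ • z.1) continuous_snd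
    (fun z => smul_inv_smul z.2 z.1) (s := fun z => s (z.2⁻¹ • z.1))
    (hs.comp (by fun_prop : Continuous fun z : X × G => z.2⁻¹ • z.1))

/-- Generators of one fiber, extended with constant coordinates in a chart and cut off by a bump
function, generate wherever the bump equals `1`. Finite unions cover `X`. -/
theorem exists_generating_sections [CompactSpace X] [T2Space X] (hE : E.IsGBundle) :
    ∃ S : Set (∀ x, E.Fiber x), S.Finite ∧
      (∀ s ∈ S, Continuous fun x => (⟨x, s x⟩ : Tot E.Fiber)) ∧
      ∀ x, Submodule.span (𝒜.Fiber x) ((fun s : ∀ x, E.Fiber x => s x) '' S) = ⊤ := by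
  suffices H : ∃ S : Set (∀ x, E.Fiber x), S.Finite ∧
      (∀ s ∈ S, Continuous fun x => (⟨x, s x⟩ : Tot E.Fiber)) ∧
      ∀ x ∈ univ, Submodule.span (𝒜.Fiber x) ((fun s : ∀ x, E.Fiber x => s x) '' S) = ⊤ by
    simpa using H
  refine isCompact_univ.induction_on (p := fun K : Set X => ∃ S : Set (∀ x, E.Fiber x), S.Finite ∧
      (∀ s ∈ S, Continuous fun x => (⟨x, s x⟩ : Tot E.Fiber)) ∧
      ∀ x ∈ K, Submodule.span (𝒜.Fiber x) ((fun s : ∀ x, E.Fiber x => s x) '' S) = ⊤)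
    ⟨∅, finite_empty, by simp, by simp⟩ ?_ ?_ ?_
  · rintro K K' hK ⟨S, h1, h2, h3⟩
    exact ⟨S, h1, h2, fun x hx => h3 x (hK hx)⟩
  · rintro K K' ⟨S, h1, h2, h3⟩ ⟨S', h1', h2', h3'⟩
    refine ⟨S ∪ S', h1.union h1', fun s hs => hs.elim (h2 s) (h2' s), fun x hx => ?_⟩
    rw [image_union, Submodule.span_union]
    rcases hx with hx | hx
    · rw [h3 x hx, top_sup_eq]
    · rw [h3' x hx, sup_top_eq]
  · intro x₀ _
    obtain ⟨P, _, _, _, _, _, _, c, hc⟩ := hE.locally_trivial.exists_moduleChart x₀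
    have := hE.finite x₀
    obtain ⟨n, e, he⟩ := Module.Finite.exists_fin (R := 𝒜.Fiber x₀) (M := E.Fiber x₀)
    rw [c.span_eq_top_iff hc] at he
    obtain ⟨χ, hχ, hχ1, -⟩ := exists_bump (c.isOpen_domain.mem_nhds hc)
    let s : Fin n → ∀ x, E.Fiber x := fun i x => χ x • c.symm x (c.coord x₀ (e i))
    refine ⟨{x | χ x = 1} ∩ c.domain, mem_nhdsWithin_of_mem_nhds
      (inter_mem hχ1 (c.isOpen_domain.mem_nhds hc)), range s, finite_range s, ?_, ?_⟩
    · rintro _ ⟨i, rfl⟩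
      exact hE.isBanachBundle.continuous_smul_of_tsupport χ.continuous hχ continuous_id
        (h := fun x => c.symm x (c.coord x₀ (e i))) fun x hx =>
          c.continuousAt_symm (q := id) continuousAt_id hx continuousAt_const
    · rintro x ⟨hx1, hx⟩
      have hx1 : χ x = 1 := hx1
      rw [← range_comp, c.span_eq_top_iff hx, ← he]
      congr 2
      ext i
      simp [s, hx1, c.coord_symm x hx]

end IsGBundle

section Smear

variable [CompactSpace G] [T2Space G] [SecondCountableTopology G] [MeasurableSpace G]
  [BorelSpace G] (μ : Measure G) [IsProbabilityMeasure μ] [μ.IsMulLeftInvariant]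

namespace IsGBundle

variable {E : GModuleFamily.{v, w} 𝒜} (hE : E.IsGBundle)

/-- The average of the translates of a section against an `L²` weight. -/
noncomputable def smear (hE : E.IsGBundle) (w : Lp ℝ 2 μ) (s : ∀ x, E.Fiber x) (x : X) :
    E.Fiber x :=
  hE.isBanachBundle.fiberIntegral μ w x fun g => E.translate g s x

variable {s : ∀ x, E.Fiber x}

theorem continuous_translate_left (hE : E.IsGBundle)
    (hs : Continuous fun x => (⟨x, s x⟩ : Tot E.Fiber)) (x : X) :
    Continuous fun g => (⟨x, E.translate g s x⟩ : Tot E.Fiber) :=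
  (hE.continuous_translate hs).comp (Continuous.prodMk_right x)

theorem continuous_smear (hE : E.IsGBundle)
    (hs : Continuous fun x => (⟨x, s x⟩ : Tot E.Fiber)) :
    Continuous fun z : Lp ℝ 2 μ × X => (⟨z.2, hE.smear μ z.1 s z.2⟩ : Tot E.Fiber) :=
  hE.isBanachBundle.continuous_fiberIntegral μ (q := fun x => x)
    (h := fun x g => E.translate g s x) continuous_id (hE.continuous_translate hs)

theorem smear_add (hE : E.IsGBundle)
    (hs : Continuous fun x => (⟨x, s x⟩ : Tot E.Fiber)) (w w' : Lp ℝ 2 μ) (x : X) :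
    hE.smear μ (w + w') s x = hE.smear μ w s x + hE.smear μ w' s x :=
  hE.isBanachBundle.fiberIntegral_add_weight μ w w' (hE.continuous_translate_left hs x)

theorem smear_smul (hE : E.IsGBundle)
    (hs : Continuous fun x => (⟨x, s x⟩ : Tot E.Fiber)) (r : ℝ) (w : Lp ℝ 2 μ) (x : X) :
    hE.smear μ (r • w) s x = r • hE.smear μ w s x :=
  hE.isBanachBundle.fiberIntegral_smul_weight μ r w (hE.continuous_translate_left hs x)

/-- Formally `k · ∫ w(g) (g · s) = ∫ w(g) (kg · s) = ∫ w(k⁻¹g) (g · s)`: smearing intertwines the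
left regular representation with the action on sections. -/
theorem act_smear (hE : E.IsGBundle)
    (hs : Continuous fun x => (⟨x, s x⟩ : Tot E.Fiber)) (k : G) (w : Lp ℝ 2 μ) (x : X) :
    E.act k x (hE.smear μ w s x) = hE.smear μ (leftTranslation μ k w) s (k • x) := by
  have h1 := hE.continuous_translate_left hs
  have h2 := hE.isBanachBundle.linearMap_fiberIntegral μ hE.isBanachBundle w (h1 x)
    (hE.actLinear k rfl) (hE.fiberContinuous_actLinear k rfl)
  rw [hE.actLinear_apply, E.actTo_rfl] at h2
  simp only [hE.actLinear_apply, hE.actTo_translate] at h2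
  rw [smear, smear, hE.isBanachBundle.fiberIntegral_leftTranslation μ k w (h1 _), h2]

end IsGBundle

end Smear

end GModuleFamily

end Sections

/-! ### A finite-dimensional invariant space of generating sections -/

section Approximation

theorem exists_density {G : Type*} [TopologicalSpace G] [CompactSpace G] [T2Space G]
    [MeasurableSpace G] [BorelSpace G] (μ : Measure G) [IsProbabilityMeasure μ]
    [μ.IsOpenPosMeasure] {x : G} {V : Set G} (hV : V ∈ 𝓝 x) :
    ∃ φ : C(G, ℝ), (∀ g, 0 ≤ φ g) ∧ ∫ g, φ g ∂μ = 1 ∧ ∀ g ∉ V, φ g = 0 := by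
  obtain ⟨χ, h1, h2, h3⟩ := exists_bump hV
  have hpos : 0 < ∫ g, χ g ∂μ :=
    χ.continuous.integral_pos_of_hasCompactSupport_nonneg_nonzero
      (HasCompactSupport.of_compactSpace _) h3 (x := x) (by rw [h2.self_of_nhds]; exact one_ne_zero)
  refine ⟨(∫ g, χ g ∂μ)⁻¹ • χ, fun g => ?_, ?_, fun g hg => ?_⟩
  · exact mul_nonneg (inv_nonneg.2 hpos.le) (h3 g)
  · simp only [ContinuousMap.smul_apply, smul_eq_mul]
    rw [integral_const_mul, inv_mul_cancel₀ hpos.ne']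
  · rw [ContinuousMap.smul_apply, image_eq_zero_of_notMem_tsupport fun h => hg (h1 h), smul_zero]

variable {G : Type*} [Group G] [TopologicalSpace G] [IsTopologicalGroup G]
  {X : Type*} [TopologicalSpace X] [MulAction G X] [ContinuousSMul G X]
  {A : Type uA} [NormedRing A] [NormedAlgebra ℝ A] [CompleteSpace A]
  {𝒜 : GAlgebraBundle.{v} G X A}

namespace GModuleFamily

namespace IsGBundle

variable [CompactSpace G] [T2Space G] [SecondCountableTopology G] [MeasurableSpace G]
  [BorelSpace G] (μ : Measure G) [IsProbabilityMeasure μ] [μ.IsMulLeftInvariant]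
  [CompactSpace X]
  {E : GModuleFamily.{v, w} 𝒜} {ι : Type*} [Fintype ι] {s : ι → ∀ x, E.Fiber x}

/-- Smearing generating sections against a density concentrated near `1` gives generating
sections. -/
theorem exists_nhds_span_smear_eq_top (hE : E.IsGBundle)
    (hs : ∀ i, Continuous fun x => (⟨x, s i x⟩ : Tot E.Fiber))
    (hgen : ∀ x, Submodule.span (𝒜.Fiber x) (range fun i => s i x) = ⊤) :
    ∃ V ∈ 𝓝 (1 : G), ∀ φ : C(G, ℝ), (∀ g, 0 ≤ φ g) → ∫ g, φ g ∂μ = 1 → (∀ g ∉ V, φ g = 0) →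
      ∀ x, Submodule.span (𝒜.Fiber x)
        (range fun i => hE.smear μ (ContinuousMap.toLp 2 μ ℝ φ) (s i) x) = ⊤ := by
  suffices H : ∃ V ∈ 𝓝 (1 : G), ∀ φ : C(G, ℝ), (∀ g, 0 ≤ φ g) → ∫ g, φ g ∂μ = 1 →
      (∀ g ∉ V, φ g = 0) → ∀ x ∈ univ, Submodule.span (𝒜.Fiber x)
        (range fun i => hE.smear μ (ContinuousMap.toLp 2 μ ℝ φ) (s i) x) = ⊤ by
    simpa using H
  refine isCompact_univ.induction_on (p := fun K : Set X => ∃ V ∈ 𝓝 (1 : G), ∀ φ : C(G, ℝ),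
      (∀ g, 0 ≤ φ g) → ∫ g, φ g ∂μ = 1 →
      (∀ g ∉ V, φ g = 0) → ∀ x ∈ K, Submodule.span (𝒜.Fiber x)
        (range fun i => hE.smear μ (ContinuousMap.toLp 2 μ ℝ φ) (s i) x) = ⊤)
    ⟨univ, univ_mem, by simp⟩ ?_ ?_ ?_
  · rintro K K' hK ⟨V, hV, h⟩
    exact ⟨V, hV, fun φ h1 h2 h3 x hx => h φ h1 h2 h3 x (hK hx)⟩
  · rintro K K' ⟨V, hV, h⟩ ⟨V', hV', h'⟩
    refine ⟨V ∩ V', inter_mem hV hV', fun φ h1 h2 h3 x hx => ?_⟩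
    rcases hx with hx | hx
    · exact h φ h1 h2 (fun g hg => h3 g fun hg' => hg hg'.1) x hx
    · exact h' φ h1 h2 (fun g hg => h3 g fun hg' => hg hg'.2) x hx
  · intro x₀ _
    obtain ⟨P, _, _, _, _, _, _, c, hc⟩ := hE.locally_trivial.exists_moduleChart x₀
    have := hE.projective x₀
    have := c.projective hc
    let p₀ : ι → P := fun i => c.coord x₀ (s i x₀)
    have hp₀ : Submodule.span A (range p₀) = ⊤ := (c.span_eq_top_iff hc _).1 (hgen x₀)
    obtain ⟨δ, hδ, hball⟩ := Metric.eventually_nhds_iff_ball.1 (eventually_span_eq_top hp₀)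
    have hcont : ∀ i, ContinuousAt
        (fun z : X × G => c.coord z.1 (E.translate z.2 (s i) z.1)) (x₀, 1) := fun i =>
      (c.continuousAt_iff (q := fun z : X × G => z.1)
        (h := fun z : X × G => E.translate z.2 (s i) z.1) continuousAt_fst hc).1
        (hE.continuous_translate (hs i)).continuousAt
    -- The translates `g · s i` near `x₀` with `g` near `1` are compared with the single vector `p₀
    -- i`. The bound is `δ / 2` because averaging keeps only a weak inequality, while the ball of
    -- radius `δ` is open.
    have hev : ∀ᶠ z : X × G in 𝓝 (x₀, 1),
        ∀ i, ‖c.coord z.1 (E.translate z.2 (s i) z.1) - p₀ i‖ < δ / 2 := by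
      refine eventually_all.2 fun i => ?_
      have h1 := (hcont i).eventually (Metric.ball_mem_nhds _ (half_pos hδ))
      simp only [hE.translate_one] at h1
      filter_upwards [h1] with z hz
      rwa [← dist_eq_norm]
    rw [nhds_prod_eq] at hev
    obtain ⟨U, hU, V, hV, hUV⟩ := mem_prod_iff.1 hev
    refine ⟨U ∩ c.domain, mem_nhdsWithin_of_mem_nhds
      (inter_mem hU (c.isOpen_domain.mem_nhds hc)), V, hV, fun φ h1 h2 h3 x hx => ?_⟩
    rw [c.span_eq_top_iff hx.2]
    refine hball _ ?_
    rw [Metric.mem_ball, dist_pi_lt_iff hδ]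
    intro i
    have hF : Continuous fun g => c.coord x (E.translate g (s i) x) :=
      (c.fiberContinuous hx.2).comp_lift (hE.continuous_translate_left (hs i) x)
    have hφi : Integrable φ μ :=
      φ.continuous.integrable_of_hasCompactSupport (HasCompactSupport.of_compactSpace _)
    have e1 : c.coord x (hE.smear μ (ContinuousMap.toLp 2 μ ℝ φ) (s i) x) =
        ∫ g, φ g • c.coord x (E.translate g (s i) x) ∂μ := by
      rw [smear, hE.isBanachBundle.map_fiberIntegral μ _ (hE.continuous_translate_left (hs i) x) _
        (c.fiberContinuous hx.2)]
      refine integral_congr_ae ?_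
      filter_upwards [ContinuousMap.coeFn_toLp (p := 2) μ (𝕜 := ℝ) φ] with g hg
      rw [hg]
    -- As `φ` has mass `1`, `p₀ i` is its own average, and the difference becomes a single integral.
    have e2 : p₀ i = ∫ g, φ g • p₀ i ∂μ := by rw [integral_smul_const, h2, one_smul]
    have hi1 : Integrable (fun g => φ g • c.coord x (E.translate g (s i) x)) μ :=
      (φ.continuous.smul hF).integrable_of_hasCompactSupport (HasCompactSupport.of_compactSpace _)
    rw [dist_eq_norm, e1]
    nth_rw 1 [e2]
    rw [← integral_sub hi1 (hφi.smul_const _)]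
    refine lt_of_le_of_lt ?_ (half_lt_self hδ)
    calc _ ≤ ∫ g, φ g * (δ / 2) ∂μ :=
          norm_integral_le_of_norm_le (hφi.mul_const _) (Eventually.of_forall fun g => ?_)
      _ = δ / 2 := by rw [integral_mul_const, h2, one_mul]
    rw [← smul_sub, norm_smul, Real.norm_of_nonneg (h1 g)]
    by_cases hg : g ∈ V
    · exact mul_le_mul_of_nonneg_left (hUV (mk_mem_prod hx.1 hg) i).le (h1 g)
    · rw [h3 g hg]; simp

/-- The weights whose smearing gives generating sections form an open set. -/
theorem eventually_span_smear_eq_top (hE : E.IsGBundle)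
    (hs : ∀ i, Continuous fun x => (⟨x, s i x⟩ : Tot E.Fiber)) {w₀ : Lp ℝ 2 μ}
    (hw₀ : ∀ x, Submodule.span (𝒜.Fiber x) (range fun i => hE.smear μ w₀ (s i) x) = ⊤) :
    ∀ᶠ w in 𝓝 w₀, ∀ x,
      Submodule.span (𝒜.Fiber x) (range fun i => hE.smear μ w (s i) x) = ⊤ := by
  suffices H : ∀ᶠ w in 𝓝 w₀, ∀ x ∈ univ,
      Submodule.span (𝒜.Fiber x) (range fun i => hE.smear μ w (s i) x) = ⊤ by simpa using H
  refine isCompact_univ.eventually_forall_of_forall_eventually fun x₀ _ => ?_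
  obtain ⟨P, _, _, _, _, _, _, c, hc⟩ := hE.locally_trivial.exists_moduleChart x₀
  have := hE.projective x₀
  have := c.projective hc
  have hcont : ContinuousAt (fun z : Lp ℝ 2 μ × X =>
      fun i => c.coord z.2 (hE.smear μ z.1 (s i) z.2)) (w₀, x₀) :=
    continuousAt_pi.2 fun i => (c.continuousAt_iff (q := fun z : Lp ℝ 2 μ × X => z.2)
        (h := fun z : Lp ℝ 2 μ × X => hE.smear μ z.1 (s i) z.2) continuousAt_snd hc).1
        (hE.continuous_smear μ (hs i)).continuousAt
  have h1 := hcont.eventually (eventually_span_eq_top ((c.span_eq_top_iff hc _).1 (hw₀ x₀)))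
  have h2 : ∀ᶠ z : Lp ℝ 2 μ × X in 𝓝 (w₀, x₀), z.2 ∈ c.domain :=
    continuousAt_snd (c.isOpen_domain.mem_nhds hc)
  filter_upwards [h1, h2] with z hz1 hz2
  exact (c.span_eq_top_iff hz2 _).2 hz1

end IsGBundle

/-- Transport of an invariant space of generating sections to coordinates. -/
theorem exists_representation_fin {E : GModuleFamily.{v, w} 𝒜} {M : Type*} [NormedAddCommGroup M]
    [NormedSpace ℝ M] [FiniteDimensional ℝ M] (ρ₀ : Representation ℝ G M)
    (S : M →ₗ[ℝ] ∀ x, E.Fiber x) (hρ₀ : Continuous fun p : G × M => ρ₀ p.1 p.2)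
    (hS : ∀ m, Continuous fun x => (⟨x, S m x⟩ : Tot E.Fiber))
    (hact : ∀ g m x, E.act g x (S m x) = S (ρ₀ g m) (g • x))
    (hgen : ∀ x, Submodule.span (𝒜.Fiber x) (range fun m => S m x) = ⊤) :
    ∃ (d : ℕ) (ρ : Representation ℝ G (Fin d → ℝ)) (S : (Fin d → ℝ) →ₗ[ℝ] ∀ x, E.Fiber x),
      Continuous (fun p : G × (Fin d → ℝ) => ρ p.1 p.2) ∧
      (∀ m, Continuous fun x => (⟨x, S m x⟩ : Tot E.Fiber)) ∧
      (∀ g m x, E.act g x (S m x) = S (ρ g m) (g • x)) ∧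
      ∀ x, Submodule.span (𝒜.Fiber x) (range fun i => S (Pi.single i 1) x) = ⊤ := by
  let e : M ≃ₗ[ℝ] (Fin (Module.finrank ℝ M) → ℝ) := (Module.finBasis ℝ M).equivFun
  refine ⟨_, { toFun := fun g => e.toLinearMap ∘ₗ ρ₀ g ∘ₗ e.symm.toLinearMap
               map_one' := by ext; simp
               map_mul' := fun g k => by ext; simp },
    S ∘ₗ e.symm.toLinearMap, ?_, fun m => hS _, fun g m x => ?_, fun x => ?_⟩
  · have he : Continuous e := e.toLinearMap.continuous_of_finiteDimensional
    have he' : Continuous e.symm := e.symm.toLinearMap.continuous_of_finiteDimensional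
    exact he.comp (hρ₀.comp (continuous_fst.prodMk (he'.comp continuous_snd)))
  · change E.act g x (S (e.symm m) x) = S (e.symm (e (ρ₀ g (e.symm m)))) (g • x)
    rw [hact, e.symm_apply_apply]
  · rw [eq_top_iff, ← hgen x, Submodule.span_le]
    rintro _ ⟨m, rfl⟩
    have e2 : e m = ∑ j, e m j • (Pi.single j (1 : ℝ) : Fin _ → ℝ) := by
      ext k
      simp [Finset.sum_apply, Pi.single_apply]
    have e3 : S m x = ∑ j, e m j • S (e.symm (Pi.single j 1)) x := by
      conv_lhs => rw [← e.symm_apply_apply m, e2]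
      simp
    change S m x ∈ _
    rw [e3]
    refine Submodule.sum_mem _ fun j _ => ?_
    rw [real_smul_def]
    exact Submodule.smul_mem _ _ (Submodule.subset_span ⟨j, rfl⟩)

/-- A `G`-`𝒜` bundle over a compact space is generated by a finite-dimensional invariant space of
sections. -/
theorem IsGBundle.exists_representation [CompactSpace G] [T2Space G] [SecondCountableTopology G]
    [CompactSpace X] [T2Space X] {E : GModuleFamily.{v, w} 𝒜} (hE : E.IsGBundle) :
    ∃ (d : ℕ) (ρ : Representation ℝ G (Fin d → ℝ)) (S : (Fin d → ℝ) →ₗ[ℝ] ∀ x, E.Fiber x),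
      Continuous (fun p : G × (Fin d → ℝ) => ρ p.1 p.2) ∧
      (∀ m, Continuous fun x => (⟨x, S m x⟩ : Tot E.Fiber)) ∧
      (∀ g m x, E.act g x (S m x) = S (ρ g m) (g • x)) ∧
      ∀ x, Submodule.span (𝒜.Fiber x) (range fun i => S (Pi.single i 1) x) = ⊤ := by
  classical
  borelize G
  obtain ⟨μ, _, _, _⟩ : ∃ μ : Measure G, IsProbabilityMeasure μ ∧ μ.IsMulLeftInvariant ∧
      μ.IsOpenPosMeasure :=
    ⟨Measure.haarMeasure ⊤, ⟨Measure.haarMeasure_self⟩, inferInstance, inferInstance⟩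
  obtain ⟨S₀, hfin, hcont, hgen⟩ := hE.exists_generating_sections
  have := hfin.fintype
  let s : S₀ → ∀ x, E.Fiber x := Subtype.val
  have hs : ∀ i, Continuous fun x => (⟨x, s i x⟩ : Tot E.Fiber) := fun i => hcont i i.2
  have hgen' : ∀ x, Submodule.span (𝒜.Fiber x) (range fun i => s i x) = ⊤ := fun x => by
    rw [← hgen x, image_eq_range]
  obtain ⟨V, hV, hV'⟩ := hE.exists_nhds_span_smear_eq_top μ hs hgen'
  obtain ⟨φ, h1, h2, h3⟩ := exists_density μ hV
  have hev := hE.eventually_span_smear_eq_top μ hs (hV' φ h1 h2 h3)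
  -- The vector being approximated is the `L²` class of `φ`, and the neighbourhood consists of the
  -- weights whose smearing still generates every fiber.
  obtain ⟨W, hW, hinv, w₁, hw₁, hw₁'⟩ := exists_finiteDimensional_invariant (leftTranslation μ)
    (norm_leftTranslation μ)
    (continuous_leftTranslation_left μ) _ hev
  -- One copy of `W` for each generating section. Tuples with `w₁` in one slot and `0` elsewhere
  -- already map to a generating family.
  let ρ₀ : Representation ℝ G (S₀ → W) :=
    { toFun := fun g => LinearMap.pi fun i =>
        ((leftTranslation μ g).toLinearMap.restrict (hinv g)) ∘ₗ LinearMap.proj i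
      map_one' := LinearMap.ext fun m => funext fun i => Subtype.ext (by
        change leftTranslation μ 1 (m i : Lp ℝ 2 μ) = m i
        rw [map_one]; rfl)
      map_mul' := fun g k => LinearMap.ext fun m => funext fun i => Subtype.ext (by
        change leftTranslation μ (g * k) (m i : Lp ℝ 2 μ) =
          leftTranslation μ g (leftTranslation μ k (m i))
        rw [map_mul]; rfl) }
  have hρ₀ : ∀ g m i, (ρ₀ g m i : Lp ℝ 2 μ) = leftTranslation μ g (m i) := fun g m i => rfl
  let S' : (S₀ → W) →ₗ[ℝ] ∀ x, E.Fiber x :=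
    { toFun := fun m x => ∑ i, hE.smear μ (m i) (s i) x
      map_add' := fun m m' => funext fun x => by
        rw [Pi.add_apply, ← Finset.sum_add_distrib]
        exact Finset.sum_congr rfl fun i _ => hE.smear_add μ (hs i) _ _ x
      map_smul' := fun r m => funext fun x => by
        rw [Pi.smul_apply, RingHom.id_apply, Finset.smul_sum]
        exact Finset.sum_congr rfl fun i _ => hE.smear_smul μ (hs i) _ _ x }
  have hS' : ∀ m x, S' m x = ∑ i, hE.smear μ (m i) (s i) x := fun m x => rfl
  clear_value S' ρ₀
  refine exists_representation_fin ρ₀ S' ?_ (fun m => ?_) (fun g m x => ?_) (fun x => ?_)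
  · refine continuous_pi fun i => continuous_induced_rng.2 ?_
    refine ((continuous_leftTranslation μ).comp (continuous_fst.prodMk
      (continuous_subtype_val.comp ((continuous_apply i).comp continuous_snd)))).congr ?_
    exact fun p => (hρ₀ p.1 p.2 i).symm
  · simp only [hS']
    refine hE.isBanachBundle.continuous_sum (q := fun x => x) Finset.univ
      (h := fun i x => hE.smear μ (m i) (s i) x) continuous_id fun i _ => ?_
    exact (hE.continuous_smear μ (hs i)).comp (Continuous.prodMk_right _)
  · rw [hS', hS', map_sum]
    simp only [hE.act_smear μ (hs _), hρ₀]
  · rw [eq_top_iff, ← hw₁' x, Submodule.span_le]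
    rintro _ ⟨i, rfl⟩
    refine Submodule.subset_span ⟨Pi.single i ⟨w₁, hw₁⟩, ?_⟩
    change S' (Pi.single i ⟨w₁, hw₁⟩) x = _
    rw [hS', Finset.sum_eq_single i]
    · rw [Pi.single_eq_same]
    · intro j _ hj
      rw [Pi.single_eq_of_ne hj]
      have := hE.smear_smul μ (hs j) 0 0 x
      rwa [zero_smul, zero_smul] at this
    · simp

end GModuleFamily

end Approximation

/-! ### Change of the model of a chart -/

section Model

/-- Transport of the structure of a Banach module along a bijection. -/
theorem exists_banachModule_of_equiv {A : Type*} [NormedRing A] [NormedAlgebra ℝ A]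
    {P : Type*} {Q₀ : Type w}
    [NormedAddCommGroup P] [NormedSpace ℝ P] [CompleteSpace P] [Module A P] [IsScalarTower ℝ A P]
    [ContinuousSMul A P] (e₀ : Q₀ ≃ P) :
    ∃ (Q : Type w) (_ : NormedAddCommGroup Q) (_ : NormedSpace ℝ Q) (_ : CompleteSpace Q) (_ : Module A Q)
      (_ : IsScalarTower ℝ A Q) (_ : ContinuousSMul A Q) (f : P ≃L[ℝ] Q),
      ∀ (a : A) p, f (a • p) = a • f p := by
  obtain ⟨Q, e⟩ : ∃ Q : Type w, Nonempty (Q ≃ P) := ⟨Q₀, ⟨e₀⟩⟩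
  obtain ⟨e⟩ := e
  letI : AddCommGroup Q := e.addCommGroup
  letI : Module ℝ Q := e.module ℝ
  letI : Module A Q := e.module A
  let l : Q ≃ₗ[ℝ] P := e.linearEquiv ℝ
  letI : NormedAddCommGroup Q := NormedAddCommGroup.induced Q P l l.injective
  letI : NormedSpace ℝ Q := NormedSpace.induced ℝ Q P l
  let f : Q ≃ₗᵢ[ℝ] P := ⟨l, fun _ => rfl⟩
  have hf : ∀ (a : A) q, f (a • q) = a • f q := fun a q => e.apply_symm_apply _
  have hf' : ∀ (a : A) p, f.symm (a • p) = a • f.symm p := fun a p => f.injective (by simp [hf])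
  refine ⟨Q, inferInstance, inferInstance, ?_, inferInstance, ⟨fun r a q => f.injective ?_⟩, ⟨?_⟩,
    f.symm.toContinuousLinearEquiv, hf'⟩
  · exact (completeSpace_congr (e := f.toEquiv) f.isometry.isUniformEmbedding).2 inferInstance
  · rw [hf, map_smul, hf, smul_assoc]
  · have : Continuous fun z : A × Q => f.symm (z.1 • f z.2) := by fun_prop
    refine this.congr fun z => ?_
    rw [hf', f.symm_apply_apply]

variable {G : Type*} [Group G] [TopologicalSpace G]
  {X : Type*} [TopologicalSpace X] [MulAction G X]
  {A : Type uA} [NormedRing A] [NormedAlgebra ℝ A]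
  {𝒜 : GAlgebraBundle.{v} G X A}

namespace GModuleFamily

/-- Change of model of a chart. -/
noncomputable def ModuleChart.congr {E : GModuleFamily.{v, w} 𝒜} {P : Type*} [NormedAddCommGroup P]
    [NormedSpace ℝ P] [Module A P] (c : E.ModuleChart P) {Q : Type*} [NormedAddCommGroup Q]
    [NormedSpace ℝ Q] [Module A Q] (f : P ≃L[ℝ] Q) (hf : ∀ (a : A) p, f (a • p) = a • f p)
    (hproj : Continuous (TotalSpace.proj : Tot E.Fiber → X)) : E.ModuleChart Q where
  toLinearChart := c.trans c.isOpen_domain subset_rfl (fun _ => f) (fun _ => f.symm)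
    continuousOn_const continuousOn_const (by simp) (by simp) hproj
  base := c.base
  isAlgebraChart := c.isAlgebraChart
  domain_subset := c.domain_subset
  coord_smul y hy a s := by
    change f (c.coord y (a • s)) = c.base.coord y a • f (c.coord y s)
    rw [c.coord_smul y hy, hf]

/-- Local triviality asks for a model in the universe of the fibers, whereas natural models, such as
kernels in `A^d`, live in that of `A`. The chart at `x` is a bijection of the fiber with `P`, along
which the module structure is transported. -/
theorem isLocallyTrivial_of_moduleChart (E : GModuleFamily.{v, w} 𝒜)
    (hproj : Continuous (TotalSpace.proj : Tot E.Fiber → X))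
    (h : ∀ x, ∃ (P : Type p) (_ : NormedAddCommGroup P) (_ : NormedSpace ℝ P) (_ : CompleteSpace P)
      (_ : Module A P) (_ : IsScalarTower ℝ A P) (_ : ContinuousSMul A P) (c : E.ModuleChart P),
      x ∈ c.domain) : E.IsLocallyTrivial := by
  intro x
  obtain ⟨P, _, _, _, _, _, _, c₀, hc₀⟩ := h x
  obtain ⟨Q, _, _, _, _, _, _, f, hf⟩ := exists_banachModule_of_equiv (A := A)
    (⟨c₀.coord x, c₀.symm x, c₀.symm_coord x hc₀, c₀.coord_symm x hc₀⟩ : E.Fiber x ≃ P)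
  let c := c₀.congr f hf hproj
  have hc : x ∈ c.domain := hc₀
  refine ⟨Q, _, _, ‹_›, _, ‹_›, ‹_›, c.base.toTrivialization 𝒜.continuous_proj,
    c.toLinearChart.toTrivialization hproj, c.domain_subset hc, hc, c.isAlgebraChart, ?_⟩
  rintro y ⟨-, hy⟩
  exact ⟨map_add (c.coord y), c.coord_smul y hy⟩

end GModuleFamily

end Model

/-! ### The bundle `𝒜 ⊗ ℝ^d` in coordinates -/

section Tensor

variable {G : Type*} [Group G] [TopologicalSpace G]
  {X : Type*} [TopologicalSpace X] [MulAction G X]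
  {A : Type uA} [NormedRing A] [NormedAlgebra ℝ A] [CompleteSpace A]
  (𝒜 : GAlgebraBundle.{v} G X A) {d : ℕ} (ρ : Representation ℝ G (Fin d → ℝ))

namespace GModuleFamily

variable {𝒜} in
/-- Pure tensors in the fibers of `𝒜 ⊗ ℝ^d`. -/
def tensorMk {x : X} (a : 𝒜.Fiber x) (m : Fin d → ℝ) : (tensor 𝒜 ρ).Fiber x :=
  (a ⊗ₜ[ℝ] m : 𝒜.Fiber x ⊗[ℝ] (Fin d → ℝ))

variable {𝒜 ρ} in
theorem tensor_induction {x : X} {p : (tensor 𝒜 ρ).Fiber x → Prop} (t : (tensor 𝒜 ρ).Fiber x)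
    (zero : p 0) (tmul : ∀ a m, p (tensorMk ρ a m)) (add : ∀ s t, p s → p t → p (s + t)) : p t :=
  TensorProduct.induction_on t zero tmul add

theorem smul_tensorMk {x : X} (b a : 𝒜.Fiber x) (m : Fin d → ℝ) :
    b • tensorMk ρ a m = tensorMk ρ (b * a) m := rfl

/-- The coordinates of the fibers of `𝒜 ⊗ ℝ^d`, as an additive map. -/
noncomputable def tensorCoordAux (x : X) : (tensor 𝒜 ρ).Fiber x ≃+ (Fin d → 𝒜.Fiber x) :=
  (TensorProduct.piScalarRight ℝ ℝ (𝒜.Fiber x) (Fin d)).toAddEquiv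

theorem tensorCoordAux_mk {x : X} (a : 𝒜.Fiber x) (m : Fin d → ℝ) (i : Fin d) :
    tensorCoordAux 𝒜 ρ x (tensorMk ρ a m) i = m i • a := by
  change TensorProduct.piScalarRight ℝ ℝ (𝒜.Fiber x) (Fin d) (a ⊗ₜ[ℝ] m) i = _
  simp

/-- The coordinates of the fibers of `𝒜 ⊗ ℝ^d`. -/
noncomputable def tensorCoord (x : X) :
    (tensor 𝒜 ρ).Fiber x ≃ₗ[𝒜.Fiber x] (Fin d → 𝒜.Fiber x) :=
  { tensorCoordAux 𝒜 ρ x with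
    map_smul' := fun b t => by
      change tensorCoordAux 𝒜 ρ x (b • t) = b • tensorCoordAux 𝒜 ρ x t
      induction t using tensor_induction with
      | zero => rw [smul_zero, map_zero, smul_zero]
      | tmul a m =>
        ext i
        rw [smul_tensorMk, Pi.smul_apply, tensorCoordAux_mk, tensorCoordAux_mk, smul_eq_mul,
          mul_smul_comm]
      | add s t hs ht => rw [smul_add, map_add, map_add, smul_add, hs, ht] }

theorem tensorCoord_mk {x : X} (a : 𝒜.Fiber x) (m : Fin d → ℝ) (i : Fin d) :
    tensorCoord 𝒜 ρ x (tensorMk ρ a m) i = m i • a :=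
  tensorCoordAux_mk 𝒜 ρ a m i

theorem apply_eq_sum_single {N : Type*} [AddCommGroup N] [Module ℝ N]
    (f : (Fin d → ℝ) →ₗ[ℝ] N) (m : Fin d → ℝ) : f m = ∑ i, m i • f (Pi.single i 1) := by
  conv_lhs => rw [pi_eq_sum_univ m]
  rw [map_sum]
  refine Finset.sum_congr rfl fun i _ => ?_
  rw [map_smul]
  congr 2
  ext j
  simp [Pi.single_apply, eq_comm]

/-- The contraction of a fiber of `𝒜 ⊗ ℝ^d` against a linear functional. -/
noncomputable def tensorContract {x : X} (f : Module.Dual ℝ (Fin d → ℝ)) :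
    (tensor 𝒜 ρ).Fiber x →+ 𝒜.Fiber x :=
  (TensorProduct.rid ℝ (𝒜.Fiber x)).toAddMonoidHom.comp (f.lTensor (𝒜.Fiber x)).toAddMonoidHom

theorem tensorContract_mk {x : X} (f : Module.Dual ℝ (Fin d → ℝ)) (a : 𝒜.Fiber x)
    (m : Fin d → ℝ) : tensorContract 𝒜 ρ f (tensorMk ρ a m) = f m • a := by
  change TensorProduct.rid ℝ (𝒜.Fiber x) (f.lTensor (𝒜.Fiber x) (a ⊗ₜ[ℝ] m)) = _
  simp

theorem tensorContract_eq {x : X} (f : Module.Dual ℝ (Fin d → ℝ)) (t : (tensor 𝒜 ρ).Fiber x) :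
    tensorContract 𝒜 ρ f t = ∑ i, f (Pi.single i 1) • tensorCoord 𝒜 ρ x t i := by
  induction t using tensor_induction with
  | zero => simp
  | tmul a m =>
    simp only [tensorCoord_mk, tensorContract_mk, smul_smul]
    rw [← Finset.sum_smul, apply_eq_sum_single f m]
    simp [mul_comm]
  | add s t hs ht =>
    simp only [map_add, hs, ht, Pi.add_apply, smul_add, Finset.sum_add_distrib]

/-- Every functional on `ℝ^d` is a combination of the coordinate ones, so the coarsest topology for
all contractions is that of the `d`-fold fiber product of `𝒜`. -/
theorem continuous_tensor_iff {Z : Type*} [TopologicalSpace Z] {q : Z → X}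
    {t : ∀ z, (tensor 𝒜 ρ).Fiber (q z)} :
    Continuous (fun z => (⟨q z, t z⟩ : Tot (tensor 𝒜 ρ).Fiber)) ↔
      Continuous q ∧
        ∀ i, Continuous fun z => (⟨q z, tensorCoord 𝒜 ρ (q z) (t z) i⟩ : Tot 𝒜.Fiber) := by
  have key : Continuous (fun z => (⟨q z, t z⟩ : Tot (tensor 𝒜 ρ).Fiber)) ↔
      Continuous q ∧ ∀ f : Module.Dual ℝ (Fin d → ℝ),
        Continuous fun z => (⟨q z, tensorContract 𝒜 ρ f (t z)⟩ : Tot 𝒜.Fiber) := by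
    unfold tensor
    refine continuous_inf_rng.trans (and_congr continuous_induced_rng ?_)
    exact continuous_iInf_rng.trans (forall_congr' fun f => continuous_induced_rng)
  rw [key]
  refine and_congr_right fun hq => ⟨fun h i => ?_, fun h f => ?_⟩
  · have := h (LinearMap.proj i)
    simp only [tensorContract_eq] at this
    simpa [Pi.single_apply] using this
  · simp only [tensorContract_eq]
    exact 𝒜.isBanachBundle.continuous_sum Finset.univ hq fun i _ =>
      𝒜.isBanachBundle.continuous_smul hq continuous_const (h i)

theorem continuous_tensor_proj :
    Continuous (TotalSpace.proj : Tot (tensor 𝒜 ρ).Fiber → X) :=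
  ((continuous_tensor_iff 𝒜 ρ (q := TotalSpace.proj) (t := TotalSpace.snd)).1 continuous_id).1

theorem continuous_tensorCoord {Z : Type*} [TopologicalSpace Z] {q : Z → X}
    {t : ∀ z, (tensor 𝒜 ρ).Fiber (q z)}
    (ht : Continuous (fun z => (⟨q z, t z⟩ : Tot (tensor 𝒜 ρ).Fiber))) (i : Fin d) :
    Continuous fun z => (⟨q z, tensorCoord 𝒜 ρ (q z) (t z) i⟩ : Tot 𝒜.Fiber) :=
  ((continuous_tensor_iff 𝒜 ρ).1 ht).2 i

variable {𝒜} in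
/-- The chart of `𝒜 ⊗ ℝ^d` given by a chart of `𝒜`. -/
noncomputable def tensorChart (a : LinearChart 𝒜.Fiber A) (ha : 𝒜.IsAlgebraChart a) :
    (tensor 𝒜 ρ).ModuleChart (Fin d → A) where
  domain := a.domain
  isOpen_domain := a.isOpen_domain
  coord y := (LinearMap.pi fun i => a.coord y ∘ₗ LinearMap.proj i) ∘ₗ
    (tensorCoord 𝒜 ρ y).toLinearMap.restrictScalars ℝ
  symm y := ((tensorCoord 𝒜 ρ y).symm.toLinearMap.restrictScalars ℝ) ∘ₗ
    (LinearMap.pi fun i => a.symm y ∘ₗ LinearMap.proj i)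
  symm_coord y hy b := by
    change (tensorCoord 𝒜 ρ y).symm (fun i => a.symm y (a.coord y (tensorCoord 𝒜 ρ y b i))) = b
    simp [a.symm_coord y hy]
  coord_symm y hy p := by
    ext i
    change a.coord y (tensorCoord 𝒜 ρ y
      ((tensorCoord 𝒜 ρ y).symm fun i => a.symm y (p i)) i) = p i
    simp [a.coord_symm y hy]
  continuousOn_coord := by
    refine continuousOn_pi.2 fun i => ?_
    have h := continuous_tensorCoord 𝒜 ρ (q := TotalSpace.proj) (t := TotalSpace.snd)
      continuous_id i
    exact a.continuousOn_coord.comp h.continuousOn fun _ h => h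
  continuousOn_symm := by
    rw [continuousOn_iff_continuous_domRestrict]
    refine (continuous_tensor_iff 𝒜 ρ).2 ⟨by fun_prop, fun i => ?_⟩
    refine continuous_iff_continuousAt.2 fun z => ?_
    have h := a.continuousAt_symm (q := fun z : a.domain ×ˢ (univ : Set (Fin d → A)) => z.1.1)
      (p := fun z => z.1.2 i) (z₀ := z) (by fun_prop) z.2.1 (by fun_prop)
    refine h.congr (Eventually.of_forall fun z => ?_)
    change _ = (⟨z.1.1, tensorCoord 𝒜 ρ z.1.1
      ((tensorCoord 𝒜 ρ z.1.1).symm fun i => a.symm z.1.1 (z.1.2 i)) i⟩ : Tot 𝒜.Fiber)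
    simp
  base := a
  isAlgebraChart := ha
  domain_subset := subset_rfl
  coord_smul y hy b t := by
    obtain ⟨f, hf⟩ := ha y hy
    ext i
    change a.coord y (tensorCoord 𝒜 ρ y (b • t) i) = a.coord y b * a.coord y (tensorCoord 𝒜 ρ y t i)
    simp [hf]

theorem mk_tensor_act (g : G) {x y : X} (h : g • x = y) (t : (tensor 𝒜 ρ).Fiber x) :
    (⟨g • x, (tensor 𝒜 ρ).act g x t⟩ : Tot (tensor 𝒜 ρ).Fiber) =
      ⟨y, TensorProduct.map (𝒜.actTo g h).toLinearMap (ρ g) t⟩ := by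
  subst h; rfl

theorem tensor_act_mk (g : G) {x : X} (a : 𝒜.Fiber x) (m : Fin d → ℝ) :
    (tensor 𝒜 ρ).act g x (tensorMk ρ a m) = tensorMk ρ (𝒜.act g x a) (ρ g m) := rfl

theorem tensorCoord_act (g : G) (x : X) (t : (tensor 𝒜 ρ).Fiber x) (i : Fin d) :
    tensorCoord 𝒜 ρ (g • x) ((tensor 𝒜 ρ).act g x t) i =
      ∑ j, ρ g (Pi.single j 1) i • 𝒜.act g x (tensorCoord 𝒜 ρ x t j) := by
  induction t using tensor_induction with
  | zero => simp
  | tmul a m =>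
    rw [tensor_act_mk]
    simp only [tensorCoord_mk, map_smul, smul_smul]
    rw [← Finset.sum_smul, apply_eq_sum_single (ρ g) m, Finset.sum_apply]
    simp [mul_comm]
  | add s t hs ht =>
    simp only [map_add, hs, ht, Pi.add_apply, smul_add, Finset.sum_add_distrib]

theorem isGBundle_tensor (hρ : Continuous fun p : G × (Fin d → ℝ) => ρ p.1 p.2) [ContinuousSMul G X] :
    (tensor 𝒜 ρ).IsGBundle where
  locally_trivial := by
    refine isLocallyTrivial_of_moduleChart _ (continuous_tensor_proj 𝒜 ρ) fun x => ?_
    obtain ⟨a, hx, ha⟩ := 𝒜.exists_algebraChart x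
    exact ⟨Fin d → A, inferInstance, inferInstance, inferInstance, inferInstance, inferInstance,
      inferInstance, tensorChart ρ a ha, hx⟩
  continuous_smul := by
    letI := fiberProductTopology 𝒜.Fiber (tensor 𝒜 ρ).Fiber
    have h0 : Continuous fun p : Tot fun x => 𝒜.Fiber x × (tensor 𝒜 ρ).Fiber x =>
      ((⟨p.proj, p.snd.1⟩, ⟨p.proj, p.snd.2⟩) : Tot 𝒜.Fiber × Tot (tensor 𝒜 ρ).Fiber) :=
        continuous_induced_dom
    have h1 := continuous_fst.comp h0
    have h2 := continuous_snd.comp h0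
    refine (continuous_tensor_iff 𝒜 ρ
      (q := fun p : Tot fun x => 𝒜.Fiber x × (tensor 𝒜 ρ).Fiber x => p.proj)
      (t := fun p => p.snd.1 • p.snd.2)).2
      ⟨𝒜.continuous_proj.comp h1, fun i => ?_⟩
    simp only [map_smul, Pi.smul_apply, smul_eq_mul]
    exact 𝒜.continuous_mul (𝒜.continuous_proj.comp h1) h1 (continuous_tensorCoord 𝒜 ρ h2 i)
  finite x := Module.Finite.equiv (tensorCoord 𝒜 ρ x).symm
  projective x := Module.Projective.of_equiv' (tensorCoord 𝒜 ρ x).symm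
  act_one x t := by
    rw [mk_tensor_act 𝒜 ρ 1 (one_smul G x), map_one]
    have : (𝒜.actTo 1 (one_smul G x)).toLinearMap = LinearMap.id :=
      LinearMap.ext fun a => 𝒜.actTo_one _ a
    rw [this]
    change (⟨x, TensorProduct.map LinearMap.id LinearMap.id t⟩ : Tot (tensor 𝒜 ρ).Fiber) = _
    rw [TensorProduct.map_id]
    rfl
  act_mul g h x t := by
    rw [mk_tensor_act 𝒜 ρ (g * h) (mul_smul g h x), map_mul]
    have : (𝒜.actTo (g * h) (mul_smul g h x)).toLinearMap =
        (𝒜.act g (h • x)).toLinearMap ∘ₗ (𝒜.act h x).toLinearMap :=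
      LinearMap.ext fun a => (𝒜.actTo_actTo g h rfl rfl (mul_smul g h x) a).symm
    rw [this]
    change (⟨g • h • x, TensorProduct.map _ (ρ g ∘ₗ ρ h) t⟩ : Tot (tensor 𝒜 ρ).Fiber) = _
    rw [TensorProduct.map_comp]
    rfl
  continuous_act := by
    have hq : Continuous fun p : G × Tot (tensor 𝒜 ρ).Fiber => p.1 • p.2.proj :=
      continuous_fst.smul ((continuous_tensor_proj 𝒜 ρ).comp continuous_snd)
    refine (continuous_tensor_iff 𝒜 ρ (q := fun p : G × Tot (tensor 𝒜 ρ).Fiber => p.1 • p.2.proj)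
      (t := fun p => (tensor 𝒜 ρ).act p.1 p.2.proj p.2.snd)).2 ⟨hq, fun i => ?_⟩
    simp only [tensorCoord_act]
    refine 𝒜.isBanachBundle.continuous_sum Finset.univ hq fun j _ =>
      𝒜.isBanachBundle.continuous_smul hq ?_ ?_
    · exact (continuous_apply i).comp (hρ.comp (continuous_fst.prodMk continuous_const))
    · exact 𝒜.continuous_act.comp (continuous_fst.prodMk
        (continuous_tensorCoord 𝒜 ρ (q := fun p : G × Tot (tensor 𝒜 ρ).Fiber => p.2.proj)
          (t := fun p => p.2.snd) continuous_snd j))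
  act_smul g x a t := by
    induction t using tensor_induction with
    | zero => rw [smul_zero, map_zero, smul_zero]
    | tmul b m =>
      rw [smul_tensorMk, tensor_act_mk, tensor_act_mk, smul_tensorMk, map_mul]
    | add s t hs ht => rw [smul_add, map_add, map_add, smul_add, hs, ht]

end GModuleFamily

end Tensor

/-! ### Continuous and equivariant right inverses -/

section Splitting

variable {G : Type*} [Group G] [TopologicalSpace G]
  {X : Type*} [TopologicalSpace X] [MulAction G X]
  {A : Type uA} [NormedRing A] [NormedAlgebra ℝ A]
  {𝒜 : GAlgebraBundle.{v} G X A}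

theorem GAlgebraBundle.actTo_inv_cancel (𝒜 : GAlgebraBundle.{v} G X A) (g : G) {x y : X}
    (h : g⁻¹ • x = y) (h' : g • y = x) (a : 𝒜.Fiber x) : 𝒜.actTo g h' (𝒜.actTo g⁻¹ h a) = a := by
  have : ∀ (k : G) (_ : k = 1) (hk : k • x = x), 𝒜.actTo k hk a = a := by
    rintro k rfl hk
    exact 𝒜.actTo_one hk a
  rw [𝒜.actTo_actTo g g⁻¹ h h' (by simp)]
  exact this _ (mul_inv_cancel g) _

namespace GModuleFamily

theorem IsGBundle.actTo_inv_cancel {E : GModuleFamily.{v, w} 𝒜} (hE : E.IsGBundle) (g : G)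
    {x y : X} (h : g⁻¹ • x = y) (h' : g • y = x) (s : E.Fiber x) :
    E.actTo g h' (E.actTo g⁻¹ h s) = s := by
  have : ∀ (k : G) (_ : k = 1) (hk : k • x = x), E.actTo k hk s = s := by
    rintro k rfl hk
    exact hE.actTo_one hk s
  rw [hE.actTo_actTo g g⁻¹ h h' (by simp)]
  exact this _ (mul_inv_cancel g) _

/-- Near each point, the family of maps `π : T → E` is, in suitable charts, the projection of a
product `P × K` to `P`. -/
def HasSplitCharts {T : GModuleFamily.{v, w'} 𝒜} {E : GModuleFamily.{v, w} 𝒜}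
    (pr : ∀ x, T.Fiber x →ₗ[𝒜.Fiber x] E.Fiber x) : Prop :=
  ∀ x, ∃ (P : Type w) (_ : NormedAddCommGroup P) (_ : NormedSpace ℝ P) (_ : CompleteSpace P)
    (_ : Module A P) (_ : IsScalarTower ℝ A P) (_ : ContinuousSMul A P)
    (K : Type uA) (_ : NormedAddCommGroup K) (_ : NormedSpace ℝ K) (_ : CompleteSpace K)
    (_ : Module A K) (_ : IsScalarTower ℝ A K) (_ : ContinuousSMul A K)
    (c : E.ModuleChart P) (d : T.ModuleChart (P × K)),
    x ∈ d.domain ∧ d.domain ⊆ c.domain ∧ d.base = c.base ∧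
      ∀ y ∈ d.domain, ∀ t, (d.coord y t).1 = c.coord y (pr y t)

section Glue

variable {T : GModuleFamily.{v, w'} 𝒜} {E : GModuleFamily.{v, w} 𝒜}
  {pr : ∀ x, T.Fiber x →ₗ[𝒜.Fiber x] E.Fiber x}

/-- In a split chart `e ↦ (e, 0)` is a right inverse. Sums of bump multiples of such maps satisfy
`pr ∘ σ = r` with `r ≥ 0`; compactness makes `r` positive everywhere, and one divides by it. -/
theorem HasSplitCharts.exists_section [CompactSpace X] [T2Space X] (hT : T.IsGBundle)
    (hE : E.IsGBundle) (h : HasSplitCharts pr) :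
    ∃ σ : ∀ x, E.Fiber x →ₗ[𝒜.Fiber x] T.Fiber x,
      Continuous (fun p => ⟨p.proj, σ p.proj p.snd⟩ : Tot E.Fiber → Tot T.Fiber) ∧
      ∀ x e, pr x (σ x e) = e := by
  classical
  suffices H : ∃ (σ : ∀ x, E.Fiber x →ₗ[𝒜.Fiber x] T.Fiber x) (r : C(X, ℝ)),
      Continuous (fun p => ⟨p.proj, σ p.proj p.snd⟩ : Tot E.Fiber → Tot T.Fiber) ∧
      (∀ x e, pr x (σ x e) = r x • e) ∧ (∀ x, 0 ≤ r x) ∧ ∀ x ∈ univ, 0 < r x by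
    obtain ⟨σ, r, h1, h2, -, h4⟩ := H
    have h4 : ∀ x, r x ≠ 0 := fun x => (h4 x trivial).ne'
    refine ⟨fun x => (r x)⁻¹ • σ x, ?_, fun x e => ?_⟩
    · exact hT.isBanachBundle.continuous_smul hE.continuous_proj
        ((r.continuous.inv₀ h4).comp hE.continuous_proj) h1
    · rw [LinearMap.smul_apply, LinearMap.map_smul_of_tower, h2, smul_smul, inv_mul_cancel₀ (h4 x),
        one_smul]
  refine isCompact_univ.induction_on (p := fun S : Set X =>
    ∃ (σ : ∀ x, E.Fiber x →ₗ[𝒜.Fiber x] T.Fiber x) (r : C(X, ℝ)),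
      Continuous (fun p => ⟨p.proj, σ p.proj p.snd⟩ : Tot E.Fiber → Tot T.Fiber) ∧
      (∀ x e, pr x (σ x e) = r x • e) ∧ (∀ x, 0 ≤ r x) ∧ ∀ x ∈ S, 0 < r x) ?_ ?_ ?_ ?_
  · refine ⟨fun _ => 0, 0, ?_, by simp, by simp, by simp⟩
    exact continuous_iff_continuousAt.2 fun p =>
      hT.isBanachBundle.continuousAt_zero hE.continuous_proj.continuousAt
  · rintro S S' hS ⟨σ, r, h1, h2, h3, h4⟩
    exact ⟨σ, r, h1, h2, h3, fun x hx => h4 x (hS hx)⟩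
  · rintro S S' ⟨σ, r, h1, h2, h3, h4⟩ ⟨σ', r', h1', h2', h3', h4'⟩
    refine ⟨fun x => σ x + σ' x, r + r', hT.isBanachBundle.continuous_add hE.continuous_proj h1 h1',
      fun x e => ?_, fun x => add_nonneg (h3 x) (h3' x), fun x hx => ?_⟩
    · rw [LinearMap.add_apply, map_add, h2, h2', ContinuousMap.add_apply, add_smul]
    · rcases hx with hx | hx
      · exact add_pos_of_pos_of_nonneg (h4 x hx) (h3' x)
      · exact add_pos_of_nonneg_of_pos (h3 x) (h4' x hx)
  · intro x₀ _
    obtain ⟨P, _, _, _, _, _, _, K, _, _, _, _, _, _, c, d, hx, hdc, hbase, hcoord⟩ := h x₀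
    obtain ⟨χ, hχ, hχ1, hχ0⟩ := exists_bump (d.isOpen_domain.mem_nhds hx)
    -- Linearity over the fiber algebra requires both charts to use the same chart of `𝒜`. The value
    -- off the domain is irrelevant, since the bump vanishes there.
    let σ : ∀ x, E.Fiber x →ₗ[𝒜.Fiber x] T.Fiber x := fun x =>
      if hx : x ∈ d.domain then
        { toFun := fun e => d.symm x (c.coord x e, 0)
          map_add' := fun e e' => by rw [← map_add, map_add, Prod.mk_add_mk, add_zero]
          map_smul' := fun a e => by
            rw [c.coord_smul x (hdc hx), RingHom.id_apply, ← d.symm_smul hx, hbase, Prod.smul_mk,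
              smul_zero] }
      else 0
    have hσ : ∀ x ∈ d.domain, ∀ e, σ x e = d.symm x (c.coord x e, 0) := fun x hx e => by
      simp [σ, hx]
    refine ⟨{x | χ x = 1}, mem_nhdsWithin_of_mem_nhds hχ1, fun x => χ x • σ x, χ, ?_, ?_, hχ0,
      fun x hx => ?_⟩
    · refine hT.isBanachBundle.continuous_smul_of_tsupport χ.continuous hχ hE.continuous_proj
        (h := fun p : Tot E.Fiber => σ p.proj p.snd) fun p hp => ?_
      have hcc : ContinuousAt (fun p : Tot E.Fiber => c.coord p.proj p.snd) p :=
        (c.continuousAt_iff (q := fun p : Tot E.Fiber => p.proj) (h := fun p => p.snd)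
          hE.continuous_proj.continuousAt (hdc hp)).1 continuousAt_id
      refine (d.continuousAt_symm (q := fun p : Tot E.Fiber => p.proj)
        (p := fun p => (c.coord p.proj p.snd, 0)) hE.continuous_proj.continuousAt hp
        (hcc.prodMk continuousAt_const)).congr ?_
      filter_upwards [hE.continuous_proj.continuousAt (d.isOpen_domain.mem_nhds hp)] with p' hp'
      rw [hσ _ hp']
    · intro x e
      rw [LinearMap.smul_apply, LinearMap.map_smul_of_tower]
      by_cases hx : x ∈ d.domain
      · congr 1
        apply c.injective_coord (hdc hx)
        rw [← hcoord x hx, hσ x hx, d.coord_symm x hx]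
      · have : χ x = 0 := image_eq_zero_of_notMem_tsupport fun h => hx (hχ h)
        rw [this, zero_smul, zero_smul]
    · have : χ x = 1 := hx
      rw [this]; exact one_pos

variable [IsTopologicalGroup G] [ContinuousSMul G X]

/-- The conjugate of `σ` by `g`. -/
def conjugate (σ : ∀ x, E.Fiber x →ₗ[𝒜.Fiber x] T.Fiber x) (g : G) (x : X) (e : E.Fiber x) :
    T.Fiber x :=
  T.actTo g (smul_inv_smul g x) (σ (g⁻¹ • x) (E.actTo g⁻¹ rfl e))

theorem conjugate_eq (σ : ∀ x, E.Fiber x →ₗ[𝒜.Fiber x] T.Fiber x) (g : G) {x y : X}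
    (h : g⁻¹ • x = y) (h' : g • y = x) (e : E.Fiber x) :
    conjugate σ g x e = T.actTo g h' (σ y (E.actTo g⁻¹ h e)) := by
  subst h; rfl

theorem continuous_conjugate {σ : ∀ x, E.Fiber x →ₗ[𝒜.Fiber x] T.Fiber x} (hT : T.IsGBundle)
    (hE : E.IsGBundle)
    (hσ : Continuous (fun p => ⟨p.proj, σ p.proj p.snd⟩ : Tot E.Fiber → Tot T.Fiber)) :
    Continuous fun z : Tot E.Fiber × G =>
      (⟨z.1.proj, conjugate σ z.2 z.1.proj z.1.snd⟩ : Tot T.Fiber) := by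
  have h1 : Continuous fun z : Tot E.Fiber × G =>
      (⟨z.2⁻¹ • z.1.proj, E.actTo z.2⁻¹ rfl z.1.snd⟩ : Tot E.Fiber) :=
    hE.continuous_actTo (q := fun z : Tot E.Fiber × G => z.1.proj)
      (q' := fun z => z.2⁻¹ • z.1.proj) continuous_snd.inv (fun _ => rfl)
      (s := fun z => z.1.snd) continuous_fst
  exact hT.continuous_actTo (q := fun z : Tot E.Fiber × G => z.2⁻¹ • z.1.proj) continuous_snd
    (fun z => smul_inv_smul z.2 z.1.proj)
    (s := fun z => σ (z.2⁻¹ • z.1.proj) (E.actTo z.2⁻¹ rfl z.1.snd)) (hσ.comp h1)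

/-- A continuous section of a `G`-equivariant map can be averaged to a `G`-equivariant one. -/
theorem exists_equivariant_section [CompactSpace G] [T2Space G] [SecondCountableTopology G]
    (hT : T.IsGBundle) (hE : E.IsGBundle)
    (hpr : Continuous (fun p => ⟨p.proj, pr p.proj p.snd⟩ : Tot T.Fiber → Tot E.Fiber))
    (hact : ∀ g x t, pr (g • x) (T.act g x t) = E.act g x (pr x t))
    {σ : ∀ x, E.Fiber x →ₗ[𝒜.Fiber x] T.Fiber x}
    (hσ : Continuous (fun p => ⟨p.proj, σ p.proj p.snd⟩ : Tot E.Fiber → Tot T.Fiber))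
    (hprσ : ∀ x e, pr x (σ x e) = e) :
    ∃ σ : ∀ x, E.Fiber x →ₗ[𝒜.Fiber x] T.Fiber x,
      Continuous (fun p => ⟨p.proj, σ p.proj p.snd⟩ : Tot E.Fiber → Tot T.Fiber) ∧
      (∀ x e, pr x (σ x e) = e) ∧
      ∀ g x e, σ (g • x) (E.act g x e) = T.act g x (σ x e) := by
  borelize G
  obtain ⟨μ, _, _⟩ : ∃ μ : Measure G, IsProbabilityMeasure μ ∧ μ.IsMulLeftInvariant :=
    ⟨Measure.haarMeasure ⊤, ⟨Measure.haarMeasure_self⟩, inferInstance⟩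
  have hact' : ∀ g x y (h : g • x = y) t, pr y (T.actTo g h t) = E.actTo g h (pr x t) := by
    rintro g x y rfl t
    exact hact g x t
  have hc0 := continuous_conjugate hT hE hσ
  have hc : ∀ x e, Continuous fun g : G => (⟨x, conjugate σ g x e⟩ : Tot T.Fiber) := fun x e =>
    hc0.comp (Continuous.prodMk_right (⟨x, e⟩ : Tot E.Fiber))
  -- The constant weight turns the weighted integral into the plain Haar average.
  let w : Lp ℝ 2 μ := Lp.const 2 μ 1
  let I : ∀ x, E.Fiber x → T.Fiber x := fun x e =>
    hT.isBanachBundle.fiberIntegral μ w x fun g => conjugate σ g x e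
  have hadd : ∀ x e e', I x (e + e') = I x e + I x e' := fun x e e' => by
    simp only [I]
    rw [← hT.isBanachBundle.fiberIntegral_add μ w (hc x e) (hc x e')]
    congr 1
    ext g
    simp only [conjugate, map_add]
  -- Each conjugate is linear, since `g` and `g⁻¹` cancel on the scalar `a`; multiplication by `a`
  -- is continuous and real linear, so it passes through the integral.
  have hsmul : ∀ (x : X) (a : 𝒜.Fiber x) (e : E.Fiber x), I x (a • e) = a • I x e := fun x a e => by
    let j : T.Fiber x →ₗ[ℝ] T.Fiber x :=
      { toFun := fun t => a • t
        map_add' := smul_add a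
        map_smul' := fun r t => smul_comm a r t }
    have hj : FiberContinuous fun t => (⟨x, j t⟩ : Tot T.Fiber) := by
      letI := TopologicalSpace.induced (TotalSpace.mk x : T.Fiber x → Tot T.Fiber) inferInstance
      exact hT.continuous_smul_lift (Z := T.Fiber x) (q := fun _ => x) (a := fun _ => a)
        continuous_const (s := id) continuous_induced_dom
    have := hT.isBanachBundle.linearMap_fiberIntegral μ hT.isBanachBundle w (hc x e) j hj
    refine Eq.trans ?_ this.symm
    simp only [I]
    congr 1
    ext g
    change _ = a • conjugate σ g x e
    simp only [conjugate]
    rw [hE.actTo_smul, map_smul, hT.actTo_smul, 𝒜.actTo_inv_cancel]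
  refine ⟨fun x => { toFun := I x, map_add' := hadd x, map_smul' := hsmul x }, ?_, fun x e => ?_,
    fun k x e => ?_⟩
  · have h := hT.isBanachBundle.continuous_fiberIntegral μ (q := fun p : Tot E.Fiber => p.proj)
      (h := fun p g => conjugate σ g p.proj p.snd) hE.continuous_proj hc0
    exact h.comp (Continuous.prodMk_right w)
  · change pr x (I x e) = e
    have hj : FiberContinuous fun t => (⟨x, (pr x).restrictScalars ℝ t⟩ : Tot E.Fiber) := by
      letI := TopologicalSpace.induced (TotalSpace.mk x : T.Fiber x → Tot T.Fiber) inferInstance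
      have : Continuous (TotalSpace.mk x : T.Fiber x → Tot T.Fiber) := continuous_induced_dom
      exact hpr.comp this
    have := hT.isBanachBundle.linearMap_fiberIntegral μ hE.isBanachBundle w (hc x e)
      ((pr x).restrictScalars ℝ) hj
    refine Eq.trans this ?_
    -- Every conjugate is again a right inverse because `pr` is equivariant, so the integrand is
    -- constant.
    have h2 : (fun g => (pr x).restrictScalars ℝ (conjugate σ g x e)) = fun _ => e := by
      ext g
      change pr x (conjugate σ g x e) = e
      rw [conjugate, hact', hprσ, hE.actTo_inv_cancel]
    rw [h2]
    exact hE.isBanachBundle.fiberIntegral_one_const μ e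
  · change I (k • x) (E.act k x e) = T.act k x (I x e)
    have h1 := hT.isBanachBundle.linearMap_fiberIntegral μ hT.isBanachBundle w (hc x e)
      (hT.actLinear k rfl) (hT.fiberContinuous_actLinear k rfl)
    rw [hT.actLinear_apply, T.actTo_rfl] at h1
    refine Eq.trans ?_ h1.symm
    -- The constant weight is translation invariant, so `g` may be replaced by `k * g`; the
    -- conjugate by `k * g` at `k • x`, applied to `k · e`, is `k` applied to the conjugate by `g`
    -- of `e`.
    have h2 := hT.isBanachBundle.fiberIntegral_leftTranslation μ k w (hc (k • x) (E.act k x e))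
    rw [show leftTranslation μ k w = w from leftTranslation_const μ k 1] at h2
    refine Eq.trans h2 ?_
    congr 1
    ext g
    have hy : (k * g)⁻¹ • k • x = g⁻¹ • x := by rw [mul_inv_rev, mul_smul, inv_smul_smul]
    have hy' : (k * g) • g⁻¹ • x = k • x := by rw [mul_smul, smul_inv_smul]
    rw [conjugate_eq σ (k * g) hy hy', hT.actLinear_apply, conjugate,
      hT.actTo_actTo k g _ _ hy', ← E.actTo_rfl]
    congr 2
    rw [hE.actTo_actTo (k * g)⁻¹ k rfl hy (by rw [mul_inv_rev, inv_mul_cancel_right])]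
    have : ∀ (k' : G) (_ : k' = g⁻¹) (hk : k' • x = g⁻¹ • x),
        E.actTo k' hk e = E.actTo g⁻¹ rfl e := by
      rintro k' rfl hk; rfl
    exact this _ (by rw [mul_inv_rev, inv_mul_cancel_right]) _

end Glue

end GModuleFamily

end Splitting

/-! ### The complement as a kernel -/

section Kernel

variable {G : Type*} [Group G] [TopologicalSpace G]
  {X : Type*} [TopologicalSpace X] [MulAction G X]
  {A : Type uA} [NormedRing A] [NormedAlgebra ℝ A]
  {𝒜 : GAlgebraBundle.{v} G X A}

namespace GModuleFamily

variable {T : GModuleFamily.{v, w'} 𝒜} {E : GModuleFamily.{v, w} 𝒜}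
  (pr : ∀ x, T.Fiber x →ₗ[𝒜.Fiber x] E.Fiber x)
  (hact : ∀ g x t, pr (g • x) (T.act g x t) = E.act g x (pr x t))

/-- The family of kernels of an equivariant map `T → E`, as a subspace of `T`. -/
def kernel : GModuleFamily.{v, w'} 𝒜 where
  Fiber x := LinearMap.ker (pr x)
  top := TopologicalSpace.induced (fun p => (⟨p.proj, p.snd.1⟩ : Tot T.Fiber)) inferInstance
  act g x :=
    { toFun := fun t => ⟨T.act g x t.1, by rw [LinearMap.mem_ker, hact, t.2, map_zero]⟩
      map_zero' := Subtype.ext (map_zero _)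
      map_add' := fun _ _ => Subtype.ext (map_add _ _ _) }

/-- The inclusion of the kernel. -/
def kernelIncl (x : X) : (kernel pr hact).Fiber x →ₗ[𝒜.Fiber x] T.Fiber x :=
  (LinearMap.ker (pr x)).subtype

theorem kernelIncl_injective (x : X) : Function.Injective (kernelIncl pr hact x) :=
  Subtype.val_injective

theorem apply_kernelIncl (x : X) (t : (kernel pr hact).Fiber x) :
    pr x (kernelIncl pr hact x t) = 0 := t.2

theorem kernelIncl_act (g : G) (x : X) (t : (kernel pr hact).Fiber x) :
    kernelIncl pr hact (g • x) ((kernel pr hact).act g x t) = T.act g x (kernelIncl pr hact x t) :=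
  rfl

/-- An element of the kernel as an element of its family. -/
def kernelMk {x : X} (t : T.Fiber x) (ht : pr x t = 0) : (kernel pr hact).Fiber x := ⟨t, ht⟩

theorem kernelIncl_mk {x : X} (t : T.Fiber x) (ht : pr x t = 0) :
    kernelIncl pr hact x (kernelMk pr hact t ht) = t := rfl

theorem continuous_kernel_iff {Z : Type*} [TopologicalSpace Z] {f : Z → Tot (kernel pr hact).Fiber} :
    Continuous f ↔
      Continuous fun z => (⟨(f z).proj, kernelIncl pr hact _ (f z).snd⟩ : Tot T.Fiber) :=
  continuous_induced_rng

theorem continuous_kernelIncl :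
    Continuous fun p : Tot (kernel pr hact).Fiber =>
      (⟨p.proj, kernelIncl pr hact _ p.snd⟩ : Tot T.Fiber) :=
  continuous_induced_dom

theorem kernel_ext {x y : X} (h : x = y) {s : (kernel pr hact).Fiber x}
    {t : (kernel pr hact).Fiber y}
    (hst : (⟨x, kernelIncl pr hact x s⟩ : Tot T.Fiber) = ⟨y, kernelIncl pr hact y t⟩) :
    (⟨x, s⟩ : Tot (kernel pr hact).Fiber) = ⟨y, t⟩ := by
  subst h
  rw [kernelIncl_injective pr hact x (TotalSpace.mk_injective x hst)]

open Classical in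
/-- The chart of the kernel given by a split chart. -/
noncomputable def kernelChart {P K : Type*} [NormedAddCommGroup P] [NormedSpace ℝ P] [Module A P]
    [NormedAddCommGroup K] [NormedSpace ℝ K] [Module A K] (c : E.ModuleChart P)
    (d : T.ModuleChart (P × K)) (hdc : d.domain ⊆ c.domain)
    (hcoord : ∀ y ∈ d.domain, ∀ t, (d.coord y t).1 = c.coord y (pr y t)) :
    (kernel pr hact).ModuleChart K where
  domain := d.domain
  isOpen_domain := d.isOpen_domain
  coord y := LinearMap.snd ℝ P K ∘ₗ d.coord y ∘ₗ (kernelIncl pr hact y).restrictScalars ℝ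
  symm y := if hy : y ∈ d.domain then
      { toFun := fun k => kernelMk pr hact (d.symm y (0, k)) (c.injective_coord (hdc hy) (by
          rw [← hcoord y hy, d.coord_symm y hy, map_zero]))
        map_add' := fun k k' => kernelIncl_injective pr hact y (by
          rw [map_add]
          simp only [kernelIncl_mk]
          rw [← map_add, Prod.mk_add_mk, add_zero])
        map_smul' := fun r k => kernelIncl_injective pr hact y (by
          rw [RingHom.id_apply, LinearMap.map_smul_of_tower]
          simp only [kernelIncl_mk]
          rw [← map_smul, Prod.smul_mk, smul_zero]) }
    else 0
  symm_coord y hy t := by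
    simp only [hy, dif_pos]
    apply kernelIncl_injective pr hact y
    refine (kernelIncl_mk ..).trans (d.injective_coord hy ?_)
    rw [d.coord_symm y hy]
    refine Prod.ext ?_ rfl
    rw [hcoord y hy, apply_kernelIncl, map_zero]
  coord_symm y hy k := by
    simp only [hy, dif_pos]
    change (d.coord y (d.symm y (0, k))).2 = k
    rw [d.coord_symm y hy]
  continuousOn_coord := by
    have := d.continuousOn_coord.comp (continuous_kernelIncl pr hact).continuousOn
      (s := TotalSpace.proj ⁻¹' d.domain) fun _ h => h
    exact continuous_snd.comp_continuousOn this
  continuousOn_symm := by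
    rw [continuousOn_iff_continuous_domRestrict, continuous_kernel_iff]
    have h : ContinuousOn (fun z : X × K => (z.1, ((0, z.2) : P × K))) (d.domain ×ˢ univ) := by
      fun_prop
    have := (d.continuousOn_symm.comp h fun z hz => ⟨hz.1, trivial⟩).domRestrict
    refine this.congr fun z => ?_
    have hz : z.1.1 ∈ d.domain := z.2.1
    simp only [Set.domRestrict_apply, Function.comp_apply, hz, dif_pos]
    rfl
  base := d.base
  isAlgebraChart := d.isAlgebraChart
  domain_subset := d.domain_subset
  coord_smul y hy a t := by
    change (d.coord y (kernelIncl pr hact y (a • t))).2 = _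
    rw [map_smul, d.coord_smul y hy]
    rfl

variable {pr}

/-- The projection `1 - σ ∘ pr` makes each kernel a direct summand of a finitely generated
projective module; for this `σ` need be neither continuous nor equivariant. Local triviality, with
model `K`, comes from the split charts. -/
theorem isGBundle_kernel (hT : T.IsGBundle) (h : HasSplitCharts pr)
    {σ : ∀ x, E.Fiber x →ₗ[𝒜.Fiber x] T.Fiber x} (hσ : ∀ x e, pr x (σ x e) = e) :
    (kernel pr hact).IsGBundle := by
  let q : ∀ x, T.Fiber x →ₗ[𝒜.Fiber x] (kernel pr hact).Fiber x := fun x =>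
    LinearMap.codRestrict (LinearMap.ker (pr x)) (LinearMap.id - σ x ∘ₗ pr x) fun t => by
      simp [hσ]
  have hq : ∀ x, q x ∘ₗ kernelIncl pr hact x = LinearMap.id := fun x => by
    ext t
    apply kernelIncl_injective pr hact x
    change kernelIncl pr hact x t - σ x (pr x (kernelIncl pr hact x t)) = kernelIncl pr hact x t
    rw [apply_kernelIncl, map_zero, sub_zero]
  have hproj : Continuous (TotalSpace.proj : Tot (kernel pr hact).Fiber → X) :=
    hT.continuous_proj.comp (continuous_kernelIncl pr hact)
  refine ⟨isLocallyTrivial_of_moduleChart _ hproj fun x => ?_, ?_, fun x => ?_, fun x => ?_,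
    fun x t => ?_, fun g k x t => ?_, ?_, fun g x a t => ?_⟩
  · obtain ⟨P, _, _, _, _, _, _, K, i1, i2, i3, i4, i5, i6, c, d, hx, hdc, -, hcoord⟩ := h x
    exact ⟨K, i1, i2, i3, i4, i5, i6, kernelChart pr hact c d hdc hcoord, hx⟩
  · letI := fiberProductTopology 𝒜.Fiber (kernel pr hact).Fiber
    have h0 : Continuous fun p : Tot fun x => 𝒜.Fiber x × (kernel pr hact).Fiber x =>
      ((⟨p.proj, p.snd.1⟩, ⟨p.proj, p.snd.2⟩) : Tot 𝒜.Fiber × Tot (kernel pr hact).Fiber) :=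
        continuous_induced_dom
    rw [continuous_kernel_iff]
    simp only [map_smul]
    exact hT.continuous_smul_lift
      (q := fun p : Tot fun x => 𝒜.Fiber x × (kernel pr hact).Fiber x => p.proj)
      (a := fun p => p.snd.1) (s := fun p => kernelIncl pr hact p.proj p.snd.2)
      (continuous_fst.comp h0) ((continuous_kernelIncl pr hact).comp (continuous_snd.comp h0))
  · have := hT.finite x
    exact Module.Finite.of_surjective (q x)
      (Function.RightInverse.surjective fun t => LinearMap.congr_fun (hq x) t)
  · have := hT.projective x
    exact Module.Projective.of_split (kernelIncl pr hact x) (q x) (hq x)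
  · exact kernel_ext pr hact (one_smul G x) (hT.act_one x _)
  · exact kernel_ext pr hact (mul_smul g k x) (hT.act_mul g k x _)
  · rw [continuous_kernel_iff]
    simp only [kernelIncl_act]
    exact hT.continuous_act.comp
      (continuous_fst.prodMk ((continuous_kernelIncl pr hact).comp continuous_snd))
  · exact kernelIncl_injective pr hact _ (hT.act_smul g x a (kernelIncl pr hact x t))

theorem isomorphic_sum_kernel (hT : T.IsGBundle) (hE : E.IsGBundle)
    (hpr : Continuous (fun p => ⟨p.proj, pr p.proj p.snd⟩ : Tot T.Fiber → Tot E.Fiber))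
    {σ : ∀ x, E.Fiber x →ₗ[𝒜.Fiber x] T.Fiber x}
    (hσc : Continuous (fun p => ⟨p.proj, σ p.proj p.snd⟩ : Tot E.Fiber → Tot T.Fiber))
    (hσ : ∀ x e, pr x (σ x e) = e)
    (hσact : ∀ g x e, σ (g • x) (E.act g x e) = T.act g x (σ x e)) :
    (E.sum (kernel pr hact)).Isomorphic T := by
  let φ : ∀ x, (E.Fiber x × (kernel pr hact).Fiber x) ≃ₗ[𝒜.Fiber x] T.Fiber x := fun x =>
    { (σ x).coprod (kernelIncl pr hact x) with
      invFun := fun t => (pr x t, kernelMk pr hact (t - σ x (pr x t)) (by rw [map_sub, hσ, sub_self]))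
      left_inv := fun z => by
        have h : pr x (σ x z.1 + kernelIncl pr hact x z.2) = z.1 := by
          rw [map_add, hσ, apply_kernelIncl, add_zero]
        refine Prod.ext h (kernelIncl_injective pr hact x ?_)
        change σ x z.1 + kernelIncl pr hact x z.2 -
          σ x (pr x (σ x z.1 + kernelIncl pr hact x z.2)) = _
        rw [h, add_sub_cancel_left]
      right_inv := fun t => by
        change σ x (pr x t) + (t - σ x (pr x t)) = t
        abel }
  have h0 : Continuous fun p : Tot (E.sum (kernel pr hact)).Fiber =>
      ((⟨p.proj, p.snd.1⟩, ⟨p.proj, p.snd.2⟩) : Tot E.Fiber × Tot (kernel pr hact).Fiber) :=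
    continuous_induced_dom
  refine ⟨φ, ?_, ?_, fun g x s => ?_⟩
  · exact hT.isBanachBundle.continuous_add
      (q := fun p : Tot (E.sum (kernel pr hact)).Fiber => p.proj)
      (h := fun p => σ p.proj p.snd.1) (k := fun p => kernelIncl pr hact p.proj p.snd.2)
      (hE.continuous_proj.comp (continuous_fst.comp h0))
      (hσc.comp (continuous_fst.comp h0))
      ((continuous_kernelIncl pr hact).comp (continuous_snd.comp h0))
  · refine continuous_induced_rng.2 (hpr.prodMk ?_)
    refine (continuous_kernel_iff pr hact).2 ?_
    exact hT.isBanachBundle.continuous_sub (q := fun p : Tot T.Fiber => p.proj)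
      (h := fun p => p.snd) (k := fun p => σ p.proj (pr p.proj p.snd))
      hT.continuous_proj continuous_id (hσc.comp hpr)
  · change σ (g • x) (E.act g x s.1) + kernelIncl pr hact (g • x) ((kernel pr hact).act g x s.2) =
      T.act g x (σ x s.1 + kernelIncl pr hact x s.2)
    rw [hσact, kernelIncl_act, map_add]

end GModuleFamily

end Kernel

/-! ### The map from `𝒜 ⊗ ℝ^d` to `E` given by sections -/

section TensorMap

variable {G : Type*} [Group G] [TopologicalSpace G]
  {X : Type*} [TopologicalSpace X] [MulAction G X]
  {A : Type uA} [NormedRing A] [NormedAlgebra ℝ A] [CompleteSpace A]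
  {𝒜 : GAlgebraBundle.{v} G X A} {E : GModuleFamily.{v, w} 𝒜}
  {d : ℕ} (ρ : Representation ℝ G (Fin d → ℝ)) (S : (Fin d → ℝ) →ₗ[ℝ] ∀ x, E.Fiber x)

namespace GModuleFamily

/-- The map `𝒜 ⊗ ℝ^d → E`, `a ⊗ m ↦ a • S m`, given by a linear family of sections `S`. -/
noncomputable def tensorMap (x : X) : (tensor 𝒜 ρ).Fiber x →ₗ[𝒜.Fiber x] E.Fiber x :=
  ∑ i, (LinearMap.toSpanSingleton (𝒜.Fiber x) (E.Fiber x) (S (Pi.single i 1) x)) ∘ₗ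
    LinearMap.proj i ∘ₗ (tensorCoord 𝒜 ρ x).toLinearMap

theorem tensorMap_apply (x : X) (t : (tensor 𝒜 ρ).Fiber x) :
    tensorMap ρ S x t = ∑ i, tensorCoord 𝒜 ρ x t i • S (Pi.single i 1) x := by
  simp [tensorMap, LinearMap.sum_apply]

theorem continuous_tensorMap (hE : E.IsGBundle)
    (hS : ∀ m, Continuous fun x => (⟨x, S m x⟩ : Tot E.Fiber)) :
    Continuous fun p : Tot (tensor 𝒜 ρ).Fiber =>
      (⟨p.proj, tensorMap ρ S p.proj p.snd⟩ : Tot E.Fiber) := by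
  have hq := continuous_tensor_proj 𝒜 ρ
  simp only [tensorMap_apply]
  exact hE.isBanachBundle.continuous_sum Finset.univ hq fun i _ => hE.continuous_smul_lift
    (continuous_tensorCoord 𝒜 ρ (q := fun p : Tot (tensor 𝒜 ρ).Fiber => p.proj)
      (t := fun p => p.snd) continuous_id i) ((hS _).comp hq)

/-- The matrix entries of `ρ g` are real, hence move freely from the coordinates of the tensor to
the sections, where they reassemble `S (ρ g m)`. -/
theorem tensorMap_act (hE : E.IsGBundle)
    (hS : ∀ g m x, E.act g x (S m x) = S (ρ g m) (g • x)) (g : G) (x : X)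
    (t : (tensor 𝒜 ρ).Fiber x) :
    tensorMap ρ S (g • x) ((tensor 𝒜 ρ).act g x t) = E.act g x (tensorMap ρ S x t) := by
  rw [tensorMap_apply, tensorMap_apply, map_sum]
  simp only [tensorCoord_act, hE.act_smul, hS, Finset.sum_smul]
  rw [Finset.sum_comm]
  refine Finset.sum_congr rfl fun j _ => ?_
  rw [apply_eq_sum_single S, Finset.sum_apply, Finset.smul_sum]
  refine Finset.sum_congr rfl fun i _ => ?_
  rw [Pi.smul_apply, smul_assoc, smul_comm]

/-- In charts the map over `y` is the combination of vectors `s y` depending continuously on `y`.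
Paired with the fixed `κ` obtained at `x`, it is an isomorphism `A^d ≅ P × K` for `y` near `x`, norm
continuous in `y`; composing the chart of the tensor bundle with it gives the split chart. -/
theorem hasSplitCharts_tensorMap (hE : E.IsGBundle)
    (hS : ∀ m, Continuous fun x => (⟨x, S m x⟩ : Tot E.Fiber))
    (hspan : ∀ x, Submodule.span (𝒜.Fiber x) (range fun i => S (Pi.single i 1) x) = ⊤) :
    HasSplitCharts (tensorMap ρ S) := by
  intro x
  obtain ⟨P, i1, i2, i3, i4, i5, i6, c, hx⟩ := hE.locally_trivial.exists_moduleChart x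
  have := hE.projective x
  have := c.projective hx
  let s : X → Fin d → P := fun y i => c.coord y (S (Pi.single i 1) y)
  have hs : ContinuousOn s c.domain := continuousOn_pi.2 fun i y hy =>
    ((c.continuousAt_iff (q := fun y => y) (h := fun y => S (Pi.single i 1) y) continuousAt_id hy).1
      (hS _).continuousAt).continuousWithinAt
  obtain ⟨K, hK, κ, hκ, V, hV, hsV, r, hr, hlr, hrl⟩ :=
    exists_splitting (A := A) (s₀ := s x) ((c.span_eq_top_iff hx _).1 (hspan x))
  have hW : IsOpen (c.domain ∩ s ⁻¹' V) := hs.isOpen_inter_preimage c.isOpen_domain hV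
  let l : X → (Fin d → A) →L[ℝ] P × K := fun y => (combination A (s y)).prod κ
  have hl : ContinuousOn l (c.domain ∩ s ⁻¹' V) := by
    have h1 : ContinuousOn (fun y => combination A (s y)) (c.domain ∩ s ⁻¹' V) :=
      (continuous_combination A P (Fin d)).comp_continuousOn (hs.mono inter_subset_left)
    have h2 : l = fun y => (ContinuousLinearMap.inl ℝ P K).comp (combination A (s y)) +
        (ContinuousLinearMap.inr ℝ P K).comp κ := by
      ext y a <;> simp [l]
    rw [h2]
    exact (continuousOn_const.clm_comp h1).add continuousOn_const
  let e : (tensor 𝒜 ρ).ModuleChart (P × K) :=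
    { toLinearChart := (tensorChart ρ c.base c.isAlgebraChart).trans hW
        (inter_subset_left.trans c.domain_subset) l (fun y => r (s y)) hl
        (hr.comp (hs.mono inter_subset_left) fun _ h => h.2) (fun y hy => hlr _ hy.2)
        (fun y hy => hrl _ hy.2) (continuous_tensor_proj 𝒜 ρ)
      base := c.base
      isAlgebraChart := c.isAlgebraChart
      domain_subset := inter_subset_left.trans c.domain_subset
      coord_smul := fun y hy a t => by
        change (combination A (s y) _, κ _) = c.base.coord y a • (combination A (s y) _, κ _)
        rw [(tensorChart ρ c.base c.isAlgebraChart).coord_smul y (c.domain_subset hy.1),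
          combination_smul, hκ]
        rfl }
  refine ⟨P, i1, i2, i3, i4, i5, i6, K, inferInstance, inferInstance, hK.completeSpace_coe,
    inferInstance, inferInstance, inferInstance, c, e, ⟨hx, hsV⟩, inter_subset_left, rfl,
    fun y hy t => ?_⟩
  change combination A (s y) ((tensorChart ρ c.base c.isAlgebraChart).coord y t) = _
  rw [combination_apply, tensorMap_apply, map_sum]
  refine Finset.sum_congr rfl fun i _ => ?_
  rw [c.coord_smul y hy.1]
  rfl

end GModuleFamily

end TensorMap

end GBundleEmbedding

theorem mainTheorem6
    {V : Type*} [NormedAddCommGroup V] [NormedSpace ℝ V] [FiniteDimensional ℝ V]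
    {G : Type*} [Group G] [TopologicalSpace G] [T2Space G] [CompactSpace G]
    [ChartedSpace V G] [LieGroup 𝓘(ℝ, V) ∞ G]
    {X : Type*} [TopologicalSpace X] [T2Space X] [CompactSpace X]
    [MulAction G X] [ContinuousSMul G X]
    {A : Type*} [NormedRing A] [NormedAlgebra ℝ A] [CompleteSpace A]
    (𝒜 : GAlgebraBundle.{v} G X A)
    (E : GModuleFamily.{v, w} 𝒜) (hE : E.IsGBundle) :
    ∃ F : GModuleFamily.{v, v} 𝒜, F.IsGBundle ∧
      ∃ (M : Type) (_ : NormedAddCommGroup M) (_ : NormedSpace ℝ M) (_ : FiniteDimensional ℝ M)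
        (ρ : Representation ℝ G M),
        Continuous (fun p : G × M => ρ p.1 p.2) ∧
        (E.sum F).Isomorphic (GModuleFamily.tensor 𝒜 ρ) := by
  have : IsTopologicalGroup G := topologicalGroup_of_lieGroup 𝓘(ℝ, V) ∞
  -- The Lie structure serves only to give a second countable topological group, to which the
  -- integration arguments apply.
  have : SecondCountableTopology G := ChartedSpace.secondCountable_of_sigmaCompact V G
  obtain ⟨d, ρ, S, hρ, hSc, hSact, hspan⟩ := hE.exists_representation
  have hT := GModuleFamily.isGBundle_tensor 𝒜 ρ hρ
  have hpr := GModuleFamily.continuous_tensorMap ρ S hE hSc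
  have hact := GModuleFamily.tensorMap_act ρ S hE hSact
  have hsplit := GModuleFamily.hasSplitCharts_tensorMap ρ S hE hSc hspan
  obtain ⟨σ₀, hσ₀c, hσ₀⟩ := hsplit.exists_section hT hE
  obtain ⟨σ, hσc, hσ, hσact⟩ :=
    GModuleFamily.exists_equivariant_section hT hE hpr hact hσ₀c hσ₀
  exact ⟨GModuleFamily.kernel _ hact, GModuleFamily.isGBundle_kernel hact hT hsplit hσ, Fin d → ℝ,
    inferInstance, inferInstance, inferInstance, ρ, hρ,
    GModuleFamily.isomorphic_sum_kernel hact hT hE hpr hσc hσ hσact⟩
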